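/- Let $\Sigma\subset\mathbb R^3$ be one of the standard models of the simply connected complete surfaces of constant curvature: the Euclidean plane $\{x_3=1\}$ ($\kappa=0$), the unit sphere $\{x_1^2+x_2^2+x_3^2=1\}$ ($\kappa=1$), or the hyperbolic plane $\{x_1^2+x_2^2-x_3^2=-1,\ x_3>0\}$ ($\kappa=-1$), with the Riemannian metric induced by the quadratic form $x_1^2+x_2^2+\kappa x_3^2$. The geodesics of $\Sigma$ are its intersections with two-dimensional vector subspaces of $\mathbb R^3$, and the conics on $\Sigma$ are its intersections with quadrics $\{\langle Cx,x\rangle=0\}$, where $C$ is a non-zero real symmetric $3\times3$ matrix. Let $\Gamma\subset\Sigma$ be a germ at a point $O$ of regular oriented $C^2$-smooth curve with non-zero geodesic curvature. For every small $p>0$ consider the geodesics that meet $\Gamma$ at two points close to $O$ and cut off area $p$, i.e. such that the region bounded by the geodesic chord and the arc of $\Gamma$ between these two points has area $p$. Let $\gamma_p$ be the envelope of this one-parameter family of geodesics: the geodesic $\ell$ of the family touches $\gamma_p$ at the limit of its intersection points with the geodesics of the family that tend to $\ell$. Let $T_p$ be the outer billiard map generated by $\gamma_p$: for $A\in\Gamma$,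 take the geodesic through $A$ tangent to $\gamma_p$ whose chord goes from $A$ in the direction of the orientation of $\Gamma$, let $M$ be its tangency point with $\gamma_p$, and let $T_p(A)$ be the point centrally symmetric to $A$ with respect to $M$ (the point of the same geodesic such that $M$ is the midpoint of the segment joining $A$ and $T_p(A)$). We say that $\Gamma$ has the area Poritsky property if it admits a local $C^1$-smooth regular parameter $t$ such that for every sufficiently small $p>0$ there is a constant $c_p$ with $t(T_p(A))=t(A)+c_p$ for all $A\in\Gamma$ close to $O$ with $T_p(A)\in\Gamma$ close to $O$. **Theorem.** On each of these surfaces, every germ of $C^2$-smooth curve with non-zero geodesic curvature that has the area Poritsky property is a conic: there is a non-zero real symmetric $3\times 3$ matrix $C$ such that $\Gamma$ coincides with $\Sigma\cap\{\langle Cx,x\rangle=0\}$ in a neighbourhood of $O$. -/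

import Mathlib

open Filter Topology

noncomputable section

namespace AreaBilliard

/-- The ambient space `ℝ³` with coordinates `x 0, x 1, x 2`. -/
abbrev R3 : Type := Fin 3 → ℝ

/-- The three simply connected complete surfaces of constant curvature `0`, `1`, `-1`. -/
inductive Geometry where
  | euclidean
  | spherical
  | hyperbolic

/-- The curvature of the surface. -/
def Geometry.curvature : Geometry → ℝ
  | .euclidean => 0
  | .spherical => 1
  | .hyperbolic => -1

/-- The bilinear form `⟨Qx, y⟩` with `Q = diag(1, 1, κ)`. Its restriction to the tangent planes of
the surface is the Riemannian metric. -/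
def Geometry.form (S : Geometry) (x y : R3) : ℝ :=
  x 0 * y 0 + x 1 * y 1 + S.curvature * (x 2 * y 2)

/-- The standard model of the surface in `ℝ³`. -/
def Geometry.surface : Geometry → Set R3
  | .euclidean => {x | x 2 = 1}
  | .spherical => {x | x 0 ^ 2 + x 1 ^ 2 + x 2 ^ 2 = 1}
  | .hyperbolic => {x | x 0 ^ 2 + x 1 ^ 2 - x 2 ^ 2 = -1 ∧ 0 < x 2}

/-- The (complete) geodesic through two points `P`, `Q` of the surface (distinct and not antipodal):
the intersection of the surface with the plane spanned by `P` and `Q`. -/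
def Geometry.geodesic (S : Geometry) (P Q : R3) : Set R3 :=
  {x | x ∈ S.surface ∧ x ∈ Submodule.span ℝ {P, Q}}

/-- The central symmetry of the surface with respect to its point `M`: it fixes `M` and sends every
`x` to the point `x'` of the geodesic through `x` and `M` such that `M` is the midpoint of `x x'`. -/
def Geometry.centralSymmetry (S : Geometry) (M x : R3) : R3 :=
  match S with
  | .euclidean => (2 : ℝ) • M - x
  | .spherical => (2 * Geometry.form .spherical M x) • M - x
  | .hyperbolic => (-2 * Geometry.form .hyperbolic M x) • M - x

/-- The Riemannian area of a subset `R` of one of the three surfaces, computed as three times the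
Lebesgue volume of the cone over `R` with apex `0`. This is the area of the metric `form`:
see `area_image`. -/
def area (R : Set R3) : ENNReal :=
  3 * MeasureTheory.volume {y : R3 | ∃ r ∈ Set.Ioc (0 : ℝ) 1, ∃ x ∈ R, y = r • x}

/-- On the tangent plane at `x`, the form `det (x, ·, ·)` is (up to sign) the Riemannian area form.
The hypotheses say that `u` and `v` are tangent to the surface at `x`. -/
theorem Geometry.sq_det_eq_gram (S : Geometry) {x u v : R3} (hx : x ∈ S.surface)
    (hu : x 2 * u 2 + S.curvature * (x 0 * u 0 + x 1 * u 1) = 0)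
    (hv : x 2 * v 2 + S.curvature * (x 0 * v 0 + x 1 * v 1) = 0) :
    Matrix.det (Matrix.of ![x, u, v]) ^ 2 = S.form u u * S.form v v - S.form u v ^ 2 := by
  rw [Matrix.det_fin_three]
  cases S
  · simp [surface, curvature, form] at *
    rw [hx] at hu hv
    simp at hu hv
    rw [hx, hu, hv]; ring
  · simp [surface, curvature, form] at *
    have e : ∀ a b c d e f g h i : ℝ, (a*e*i - a*f*h - b*d*i + b*f*g + c*d*h - c*e*g)^2 =
      (a^2+b^2+c^2) * ((d^2+e^2+f^2)*(g^2+h^2+i^2) - (d*g+e*h+f*i)^2)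
      - (c*f+(a*d+b*e))*((c*f+(a*d+b*e))*(g^2+h^2+i^2) - (c*i+(a*g+b*h))*(d*g+e*h+f*i))
      - (c*i+(a*g+b*h))*((c*i+(a*g+b*h))*(d^2+e^2+f^2) - (c*f+(a*d+b*e))*(d*g+e*h+f*i)) := by
      intros; ring
    rw [e, hx, hu, hv]; ring
  · simp [surface, curvature, form] at *
    have e : ∀ a b c d e f g h i : ℝ, (a*e*i - a*f*h - b*d*i + b*f*g + c*d*h - c*e*g)^2 =
      -((a^2+b^2-c^2) * ((d^2+e^2-f^2)*(g^2+h^2-i^2) - (d*g+e*h-f*i)^2)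
      - (c*f+(-(b*e)+-(a*d)))*((c*f+(-(b*e)+-(a*d)))*(g^2+h^2-i^2) - (c*i+(-(b*h)+-(a*g)))*(d*g+e*h-f*i))
      - (c*i+(-(b*h)+-(a*g)))*((c*i+(-(b*h)+-(a*g)))*(d^2+e^2-f^2) - (c*f+(-(b*e)+-(a*d)))*(d*g+e*h-f*i))) := by
      intros; ring
    rw [e, hx.1, hu, hv]; ring

theorem Geometry.tangent_of_mem (S : Geometry) {D : Set (ℝ × ℝ)} (hD : IsOpen D)
    {φ : ℝ × ℝ → R3} (hφ : DifferentiableOn ℝ φ D) (hS : ∀ q ∈ D, φ q ∈ S.surface)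
    {q : ℝ × ℝ} (hq : q ∈ D) (w : ℝ × ℝ) :
    φ q 2 * fderiv ℝ φ q w 2 + S.curvature *
      (φ q 0 * fderiv ℝ φ q w 0 + φ q 1 * fderiv ℝ φ q w 1) = 0 := by
  have hd : HasFDerivAt φ (fderiv ℝ φ q) q :=
    ((hφ q hq).differentiableAt (hD.mem_nhds hq)).hasFDerivAt
  have hi := hasFDerivAt_pi'.1 hd
  have h := ((hi 2).mul (hi 2)).add
    ((((hi 0).mul (hi 0)).add ((hi 1).mul (hi 1))).const_mul S.curvature)
  have hc : HasFDerivAt (fun _ : ℝ × ℝ => (1 : ℝ)) (0 : ℝ × ℝ →L[ℝ] ℝ) q := hasFDerivAt_const _ _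
  have h2 := h.congr_of_eventuallyEq (f₁ := fun _ : ℝ × ℝ => (1 : ℝ)) (by
    filter_upwards [hD.mem_nhds hq] with z hz
    have := hS z hz
    cases S <;> simp [surface, curvature] at this ⊢
    · rw [this]; norm_num
    · linarith
    · linarith [this.1])
  have h3 := congrArg (fun L : ℝ × ℝ →L[ℝ] ℝ => L w) (h2.unique hc)
  simp at h3
  linarith

theorem Geometry.ray_unique (S : Geometry) {x y : R3} (hx : x ∈ S.surface) (hy : y ∈ S.surface)
    {r s : ℝ} (hr : 0 < r) (hs : 0 < s) (h : r • x = s • y) : r = s ∧ x = y := by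
  have h0 := congrFun h 0
  have h1 := congrFun h 1
  have h2 := congrFun h 2
  simp at h0 h1 h2
  have hrs : r = s := by
    have hsq : r ^ 2 = s ^ 2 := by
      cases S <;> simp [surface] at hx hy
      · rw [hx, hy] at h2; simp at h2; rw [h2]
      · calc r ^ 2 = (r * x 0) ^ 2 + (r * x 1) ^ 2 + (r * x 2) ^ 2 := by linear_combination (-r^2) * hx
          _ = s ^ 2 := by rw [h0, h1, h2]; linear_combination (s^2) * hy
      · calc r ^ 2 = -((r * x 0) ^ 2 + (r * x 1) ^ 2 - (r * x 2) ^ 2) := by linear_combination (r^2) * hx.1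
          _ = s ^ 2 := by rw [h0, h1, h2]; linear_combination (-s^2) * hy.1
    exact (pow_left_inj₀ hr.le hs.le two_ne_zero).1 hsq
  refine ⟨hrs, ?_⟩
  subst hrs
  exact smul_right_injective R3 hr.ne' h

/-- `area` is the Riemannian area: for an injective differentiable parametrization `φ` of a part of
the surface, it is the integral of the square root of the Gram determinant of the metric. -/
theorem area_image (S : Geometry) {D : Set (ℝ × ℝ)} (hD : IsOpen D) {φ : ℝ × ℝ → R3}
    (hφ : DifferentiableOn ℝ φ D) (hinj : Set.InjOn φ D) (hS : ∀ q ∈ D, φ q ∈ S.surface) :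
    area (φ '' D) = ∫⁻ q in D, ENNReal.ofReal (Real.sqrt
      (S.form (fderiv ℝ φ q (1, 0)) (fderiv ℝ φ q (1, 0)) *
        S.form (fderiv ℝ φ q (0, 1)) (fderiv ℝ φ q (0, 1)) -
        S.form (fderiv ℝ φ q (1, 0)) (fderiv ℝ φ q (0, 1)) ^ 2)) := by
  set G : ℝ × ℝ → ℝ := fun q => Real.sqrt
      (S.form (fderiv ℝ φ q (1, 0)) (fderiv ℝ φ q (1, 0)) *
        S.form (fderiv ℝ φ q (0, 1)) (fderiv ℝ φ q (0, 1)) -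
        S.form (fderiv ℝ φ q (1, 0)) (fderiv ℝ φ q (0, 1)) ^ 2) with hG
  let π : R3 →L[ℝ] ℝ × ℝ :=
    (ContinuousLinearMap.proj (R := ℝ) (φ := fun _ : Fin 3 => ℝ) 1).prod
      (ContinuousLinearMap.proj (R := ℝ) (φ := fun _ : Fin 3 => ℝ) 2)
  have hπ : ∀ v : R3, π v = (v 1, v 2) := fun v => rfl
  let E : Set R3 := {v | v 0 ∈ Set.Ioc (0 : ℝ) 1 ∧ π v ∈ D}
  let F : R3 → R3 := fun v => v 0 • φ (π v)
  let p0 : R3 →L[ℝ] ℝ := ContinuousLinearMap.proj (R := ℝ) (φ := fun _ : Fin 3 => ℝ) 0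
  let F' : R3 → R3 →L[ℝ] R3 := fun v =>
    v 0 • (fderiv ℝ φ (π v)).comp π + p0.smulRight (φ (π v))
  have hEm : MeasurableSet E :=
    (measurableSet_Ioc.preimage (measurable_pi_apply 0)).inter
      (hD.measurableSet.preimage π.continuous.measurable)
  have himg : {y : R3 | ∃ r ∈ Set.Ioc (0 : ℝ) 1, ∃ x ∈ φ '' D, y = r • x} = F '' E := by
    ext y
    constructor
    · rintro ⟨r, hr, _, ⟨q, hq, rfl⟩, rfl⟩
      exact ⟨![r, q.1, q.2], ⟨by simpa using hr, by simpa [hπ] using hq⟩, by simp [F, hπ]⟩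
    · rintro ⟨v, ⟨h0, hv⟩, rfl⟩
      exact ⟨v 0, h0, _, ⟨_, hv, rfl⟩, rfl⟩
  have hF' : ∀ v ∈ E, HasFDerivWithinAt F (F' v) E v := by
    intro v hv
    have hd : HasFDerivAt φ (fderiv ℝ φ (π v)) (π v) :=
      ((hφ _ hv.2).differentiableAt (hD.mem_nhds hv.2)).hasFDerivAt
    exact ((p0.hasFDerivAt (x := v)).smul (hd.comp v π.hasFDerivAt)).hasFDerivWithinAt
  have hFi : Set.InjOn F E := by
    intro v hv w hw h
    obtain ⟨h1, h2⟩ := S.ray_unique (hS _ hv.2) (hS _ hw.2) hv.1.1 hw.1.1 h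
    have h3 := hinj hv.2 hw.2 h2
    rw [hπ, hπ, Prod.mk.injEq] at h3
    ext i
    fin_cases i
    · exact h1
    · exact h3.1
    · exact h3.2
  have hdet : ∀ v ∈ E, |(F' v).det| = v 0 ^ 2 * G (π v) := by
    intro v hv
    have hb : ∀ i, F' v (Pi.single i 1) =
        v 0 • fderiv ℝ φ (π v) (π (Pi.single i 1)) + (Pi.single i (1:ℝ) : R3) 0 • φ (π v) :=
      fun i => rfl
    have h1 : (F' v).det = v 0 ^ 2 * Matrix.det
        (Matrix.of ![φ (π v), fderiv ℝ φ (π v) (1, 0), fderiv ℝ φ (π v) (0, 1)]) := by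
      have h0 : (F' v).det = Matrix.det (LinearMap.toMatrix' (F' v : R3 →ₗ[ℝ] R3)) :=
        (LinearMap.det_toMatrix' _).symm
      have hm : LinearMap.toMatrix' (F' v : R3 →ₗ[ℝ] R3) =
          Matrix.of fun i j => F' v (Pi.single j 1) i := by
        ext i j
        rw [LinearMap.toMatrix'_apply]
        rfl
      rw [h0, hm, Matrix.det_fin_three, Matrix.det_fin_three]
      simp only [Matrix.of_apply, hb, hπ]
      have hz : fderiv ℝ φ (v 1, v 2) (0, 0) = 0 := map_zero _
      simp [hz]
      ring
    rw [h1, abs_mul, abs_of_nonneg (sq_nonneg _)]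
    simp only [hG]
    rw [← S.sq_det_eq_gram (hS _ hv.2) (S.tangent_of_mem hD hφ hS hv.2 _)
        (S.tangent_of_mem hD hφ hS hv.2 _), Real.sqrt_sq_eq_abs]
  have hGm : Measurable G := by
    have h1 : ∀ w : ℝ × ℝ, ∀ i, Measurable fun q => fderiv ℝ φ q w i := fun w i =>
      (measurable_pi_apply i).comp (measurable_fderiv_apply_const ℝ φ w)
    have h2 : ∀ w z : ℝ × ℝ, Measurable fun q => S.form (fderiv ℝ φ q w) (fderiv ℝ φ q z) :=
      fun w z => (((h1 w 0).mul (h1 z 0)).add ((h1 w 1).mul (h1 z 1))).add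
        (((h1 w 2).mul (h1 z 2)).const_mul _)
    exact (((h2 _ _).mul (h2 _ _)).sub ((h2 _ _).pow_const 2)).sqrt
  have hI : ∫⁻ r in Set.Ioc (0 : ℝ) 1, ENNReal.ofReal (r ^ 2) = ENNReal.ofReal (1 / 3) := by
    rw [← MeasureTheory.ofReal_integral_eq_lintegral_ofReal,
      ← intervalIntegral.integral_of_le zero_le_one]
    · norm_num
    · exact ((continuous_pow 2).intervalIntegrable (μ := MeasureTheory.volume) 0 1).1
    · exact Eventually.of_forall fun r => sq_nonneg r
  let e : R3 ≃ᵐ ℝ × ℝ × ℝ := (MeasurableEquiv.piFinSuccAbove (fun _ : Fin 3 => ℝ) 0).trans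
    ((MeasurableEquiv.refl ℝ).prodCongr MeasurableEquiv.finTwoArrow)
  have he : MeasureTheory.MeasurePreserving e :=
    ((MeasureTheory.MeasurePreserving.id _).prod
      (MeasureTheory.volume_preserving_finTwoArrow ℝ)).comp
      (MeasureTheory.volume_preserving_piFinSuccAbove (fun _ : Fin 3 => ℝ) 0)
  have hev : ∀ v, e v = (v 0, π v) := fun v => rfl
  have hEe : E = e ⁻¹' (Set.Ioc (0 : ℝ) 1 ×ˢ D) := by
    ext v; simp [E, hev]
  have hmain : MeasureTheory.volume (F '' E) =
      ENNReal.ofReal (1 / 3) * ∫⁻ q in D, ENNReal.ofReal (G q) := by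
    rw [← MeasureTheory.setLIntegral_one,
      MeasureTheory.lintegral_image_eq_lintegral_abs_det_fderiv_mul _ hEm hF' hFi]
    have : ∫⁻ v in E, ENNReal.ofReal |(F' v).det| * 1 =
        ∫⁻ v in E, (fun z : ℝ × ℝ × ℝ => ENNReal.ofReal (z.1 ^ 2) * ENNReal.ofReal (G z.2)) (e v) :=
      MeasureTheory.setLIntegral_congr_fun hEm fun v hv => by
        simp only [hdet v hv, mul_one, hev]
        rw [ENNReal.ofReal_mul (sq_nonneg _)]
    rw [this, hEe]
    refine (he.setLIntegral_comp_preimage_emb e.measurableEmbedding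
      (fun z : ℝ × ℝ × ℝ => ENNReal.ofReal (z.1 ^ 2) * ENNReal.ofReal (G z.2)) _).trans ?_
    rw [MeasureTheory.Measure.volume_eq_prod, ← MeasureTheory.Measure.prod_restrict, ← hI]
    exact MeasureTheory.lintegral_prod_mul (f := fun r : ℝ => ENNReal.ofReal (r ^ 2))
      (g := fun q : ℝ × ℝ => ENNReal.ofReal (G q))
      (measurable_id.pow_const 2).ennreal_ofReal.aemeasurable hGm.ennreal_ofReal.aemeasurable
  rw [area, himg, hmain, ← mul_assoc]
  rw [show (3 : ENNReal) * ENNReal.ofReal (1 / 3) = 1 by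
    rw [← ENNReal.ofReal_ofNat 3, ← ENNReal.ofReal_mul (by norm_num)]; norm_num, one_mul]

/-- The conic of the surface defined by the matrix `C`. -/
def Geometry.conic (S : Geometry) (C : Matrix (Fin 3) (Fin 3) ℝ) : Set R3 :=
  {x | x ∈ S.surface ∧ x ⬝ᵥ (C.mulVec x) = 0}

/-- The (signed) geodesic curvature of a curve `γ` on the surface. As `det (x, ·, ·)` is the area
form on the tangent plane at `x`, and `γ'' - ∇γ'` is proportional to `γ`, the numerator is the area
form evaluated on `γ'` and the covariant acceleration `∇γ'`. -/
def Geometry.geodesicCurvature (S : Geometry) (γ : ℝ → R3) (s : ℝ) : ℝ :=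
  Matrix.det (Matrix.of ![γ s, deriv γ s, deriv (deriv γ) s]) /
    (Real.sqrt (S.form (deriv γ s) (deriv γ s))) ^ 3

/-- `γ` is a regular parametrization, defined near the parameter value `0`, of a germ at `γ 0` of
`C²`-smooth curve on the surface, with non-zero geodesic curvature. -/
structure IsConvexGerm (S : Geometry) (γ : ℝ → R3) : Prop where
  contDiffAt : ContDiffAt ℝ 2 γ 0
  mem_surface : ∀ᶠ s in 𝓝 (0 : ℝ), γ s ∈ S.surface
  regular : deriv γ 0 ≠ 0
  curvature_ne_zero : S.geodesicCurvature γ 0 ≠ 0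

/-- The region bounded by the arc `γ([a, b])` of a convex curve and the geodesic chord joining
its endpoints, that is, the geodesic convex hull of the arc. (Geodesic convexity on
the surface is convexity under the central projection from `0`.) -/
def Geometry.cap (S : Geometry) (γ : ℝ → R3) (a b : ℝ) : Set R3 :=
  {x | x ∈ S.surface ∧ ∃ r : ℝ, 0 < r ∧ r • x ∈ convexHull ℝ (γ '' Set.Icc a b)}

/-- The pairs of parameters `a < b` such that the geodesic through `γ a` and `γ b` cuts off
a region of area `p`. -/
def Geometry.areaChords (S : Geometry) (γ : ℝ → R3) (p : ℝ) : Set (ℝ × ℝ) :=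
  {q | q.1 < q.2 ∧ area (S.cap γ q.1 q.2) = ENNReal.ofReal p}

/-- The geodesic through `γ q.1` and `γ q.2`, a member of the one-parameter family of the geodesics
that cut off area `p`, touches the envelope of this family at `M`:
the intersection points of this geodesic with the infinitely close geodesics of the family
tend to `M`. These points `M` form the curve given by the area construction. -/
def Geometry.TouchesEnvelopeAt (S : Geometry) (γ : ℝ → R3) (p : ℝ) (q : ℝ × ℝ) (M : R3) : Prop :=
  q ∈ S.areaChords γ p ∧ M ∈ S.surface ∧
    ∀ U ∈ 𝓝 M, ∀ᶠ q' in 𝓝[S.areaChords γ p \ {q}] q,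
      (U ∩ S.geodesic (γ q.1) (γ q.2) ∩ S.geodesic (γ q'.1) (γ q'.2)).Nonempty

/-- The outer billiard map `T_p` generated by the curve given by the area construction sends the
point `γ a` to the point `γ b`. That is: some geodesic through `γ a` that cuts off area `p` (the one
issued from `γ a` in the direction of the orientation, its second intersection point with the curve
being `γ e`) touches the envelope at `M`, and `γ b` is centrally symmetric to `γ a` with respect to
`M`. Only the part of the curve parametrized by the interval `I` is used. -/
def Geometry.OuterBilliardStep (S : Geometry) (γ : ℝ → R3) (I : Set ℝ) (p a b : ℝ) : Prop :=
  a ∈ I ∧ b ∈ I ∧ ∃ e ∈ I, ∃ M : R3,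
    S.TouchesEnvelopeAt γ p (a, e) M ∧ γ b = S.centralSymmetry M (γ a)

/-- The area Poritsky property of the germ at `γ 0` of the curve `γ`: there is a local `C¹`-smooth
regular parameter `t` on the curve (written as a function of the given parameter) in which, for
every small `p > 0`, the map `T_p` is a translation. -/
def Geometry.HasAreaPoritskyProperty (S : Geometry) (γ : ℝ → R3) : Prop :=
  ∃ t : ℝ → ℝ, ContDiffAt ℝ 1 t 0 ∧ deriv t 0 ≠ 0 ∧
    ∃ δ > 0, ∃ p₀ > 0, ∀ p : ℝ, 0 < p → p < p₀ → ∃ c : ℝ, ∀ a b : ℝ,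
      S.OuterBilliardStep γ (Set.Ioo (-δ) δ) p a b → t b = t a + c

/-- The germ at `γ 0` of the curve `γ` is a conic: for all small `δ > 0`, the arc `γ((-δ, δ))` and
the conic given by some symmetric matrix `C` coincide in a neighbourhood of `γ 0`. -/
def Geometry.IsConicGerm (S : Geometry) (γ : ℝ → R3) : Prop :=
  ∃ C : Matrix (Fin 3) (Fin 3) ℝ, C ≠ 0 ∧ C.IsSymm ∧
    ∀ᶠ δ in 𝓝[>] (0 : ℝ), ∀ᶠ x in 𝓝 (γ 0), x ∈ γ '' Set.Ioo (-δ) δ ↔ x ∈ S.conic C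

end AreaBilliard

end

/-!
Write `x` for the curve, `[u, v, w]` for the determinant and `G` for the bilinear form whose unit
level set contains the surface.

The cone over the cap cut off by the chord `x(a) x(b)` is swept by the plane sectors spanned by
`x(a)` and `x(s)`, `a < s < b`. The change of variables `(s, β, α) ↦ α x(a) + β x(s)` gives the area
`A(a, b) = 3 ∫ m(G(x(a), x(s))) |[x(a), x(s), x'(s)]| ds` over `a < s < b`, where `m(σ)` is the
moment `∫∫ β` of the sector `α, β ≥ 0`, `α² + β² + 2σαβ ≤ 1` (`ConvexArc.area_cap`). Reversing the
curve gives the same formula with `b` in the place of `a`. Hence both partial derivatives of `A` are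
explicit, and they contain the same factor `m(G(x(a), x(b)))`: up to this factor and a common sign,
they are `[x(a), x(b), x'(a)]` and `[x(a), x(b), x'(b)]`. The value of `m` is never needed.

By the implicit function theorem, the chords that cut off a given area form a curve `b = ψ(a)` with
a known slope (`ConvexArc.exists_equal_area_curve`). It follows that each chord touches the
envelope at its midpoint, so that the outer billiard map sends `x(a)` to `x(b)`
(`ConvexArc.touchesEnvelopeAt_midpoint`, `ConvexArc.outerBilliardStep`). The Poritsky property then
says that `t(b) - t(a)` is constant along `ψ`; differentiating,
`[x(b), x(a), x'(a)] / t'(a) = [x(a), x(b), x'(b)] / t'(b)` for all `a < b`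
(`ConvexArc.deriv_mul_triple_eq`).

In terms of `w = (x × x') / t'` this reads `⟨x(b), w(a)⟩ = ⟨x(a), w(b)⟩`. Taking for `a` three
parameters with independent `x(a)` shows that `w = N x` for a matrix `N`, which is symmetric
(`exists_isSymm_mulVec_eq`). As `⟨x, w⟩ = 0`, the curve lies on the conic `⟨N x, x⟩ = 0`. The conic
is nonsingular at the base point because `N x = w ≠ 0` is orthogonal to `x`, so the curve fills it
there (`isConicGerm_of_mulVec_eq`).
-/

namespace AreaBilliard

/-! ### Linear algebra in `ℝ³` and the polar form of the surface -/

/-- The triple product `det (x, y, z)`, written out as a polynomial in the coordinates. -/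
def triple (x y z : R3) : ℝ :=
  x 0 * (y 1 * z 2 - y 2 * z 1) - x 1 * (y 0 * z 2 - y 2 * z 0) + x 2 * (y 0 * z 1 - y 1 * z 0)

theorem det_eq_triple (x y z : R3) : Matrix.det (Matrix.of ![x, y, z]) = triple x y z := by
  rw [Matrix.det_fin_three]; simp [triple]; ring

theorem triple_add_smul_third (x y z w : R3) (α β : ℝ) :
    triple x y (α • z + β • w) = α * triple x y z + β * triple x y w := by
  simp [triple]; ring

theorem triple_rotate (x y z : R3) : triple x y z = triple y z x := by simp [triple]; ring

theorem triple_swap (x y z : R3) : triple x z y = -triple x y z := by simp [triple]; ring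

theorem triple_self_left (x y : R3) : triple x x y = 0 := by simp [triple]; ring

theorem triple_self_right (x y : R3) : triple x y y = 0 := by simp [triple]; ring

theorem triple_self_outer (x y : R3) : triple x y x = 0 := by simp [triple]; ring

/-- Cramer's rule: the expansion of `z` in the basis `x, y, w`. -/
theorem triple_smul_eq (x y w z : R3) :
    triple x y w • z = triple z y w • x + triple x z w • y + triple x y z • w := by
  ext i; fin_cases i <;> simp [triple] <;> ring

theorem hasDerivAt_coord {f : ℝ → R3} {f' : R3} {s : ℝ} (h : HasDerivAt f f' s) (i : Fin 3) :
    HasDerivAt (fun u => f u i) (f' i) s := hasDerivAt_pi.1 h i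

theorem hasDerivAt_triple_third {f : ℝ → R3} {f' : R3} {s : ℝ} (h : HasDerivAt f f' s)
    (x y : R3) : HasDerivAt (fun u => triple x y (f u)) (triple x y f') s := by
  have h0 := hasDerivAt_coord h 0
  have h1 := hasDerivAt_coord h 1
  have h2 := hasDerivAt_coord h 2
  unfold triple
  exact ((((h2.const_mul (y 1)).sub (h1.const_mul (y 2))).const_mul (x 0)).sub
    (((h2.const_mul (y 0)).sub (h0.const_mul (y 2))).const_mul (x 1))).add
    (((h1.const_mul (y 0)).sub (h0.const_mul (y 1))).const_mul (x 2))

theorem hasDerivAt_triple_second {f : ℝ → R3} {f' : R3} {s : ℝ} (h : HasDerivAt f f' s)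
    (x z : R3) : HasDerivAt (fun u => triple x (f u) z) (triple x f' z) s := by
  simp only [triple_swap x z]
  exact (hasDerivAt_triple_third h x z).neg

theorem continuous_triple : Continuous fun v : R3 × R3 × R3 => triple v.1 v.2.1 v.2.2 := by
  unfold triple; fun_prop

/-- The bilinear form whose unit level set contains the surface: the surface is
`{G(x, x) = 1}`, cut down to `x₃ > 0` in the Euclidean and hyperbolic cases. -/
def Geometry.polar (S : Geometry) (x y : R3) : ℝ :=
  x 2 * y 2 + S.curvature * (x 0 * y 0 + x 1 * y 1)

theorem Geometry.polar_comm (S : Geometry) (x y : R3) : S.polar x y = S.polar y x := by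
  simp [polar]; ring

theorem Geometry.polar_smul_self (S : Geometry) (r : ℝ) (x : R3) :
    S.polar (r • x) (r • x) = r ^ 2 * S.polar x x := by
  simp [polar]; ring

theorem Geometry.continuous_polar (S : Geometry) :
    Continuous fun v : R3 × R3 => S.polar v.1 v.2 := by
  unfold polar; fun_prop

theorem Geometry.mem_surface_iff (S : Geometry) (x : R3) :
    x ∈ S.surface ↔ S.polar x x = 1 ∧ (S = .spherical ∨ 0 < x 2) := by
  cases S <;> simp [surface, polar, curvature]
  · constructor
    · intro h; simp [h]
    · rintro ⟨h1, h2⟩; nlinarith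
  · constructor <;> intro h <;> nlinarith
  · intro _
    constructor <;> intro h <;> nlinarith

theorem Geometry.polar_self (S : Geometry) {x : R3} (hx : x ∈ S.surface) : S.polar x x = 1 :=
  ((S.mem_surface_iff x).1 hx).1

theorem Geometry.polar_comb (S : Geometry) {x y : R3} (hx : x ∈ S.surface) (hy : y ∈ S.surface)
    (α β : ℝ) : S.polar (α • x + β • y) (α • x + β • y) =
      α ^ 2 + β ^ 2 + 2 * S.polar x y * α * β := by
  have h1 := S.polar_self hx
  have h2 := S.polar_self hy
  simp only [polar, Pi.add_apply, Pi.smul_apply, smul_eq_mul] at *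
  linear_combination α ^ 2 * h1 + β ^ 2 * h2

/-- The radial projection of `x` to the surface. -/
noncomputable def Geometry.normalize (S : Geometry) (x : R3) : R3 := (Real.sqrt (S.polar x x))⁻¹ • x

theorem Geometry.normalize_mem (S : Geometry) {x : R3} (h : 0 < S.polar x x)
    (h' : S = .spherical ∨ 0 < x 2) : S.normalize x ∈ S.surface := by
  have h0 := Real.sqrt_pos.2 h
  rw [mem_surface_iff]
  refine ⟨?_, h'.imp_right fun h2 => ?_⟩
  · rw [normalize, polar_smul_self, inv_pow, Real.sq_sqrt h.le, inv_mul_cancel₀ h.ne']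
  · simp only [normalize, Pi.smul_apply, smul_eq_mul]
    positivity

theorem Geometry.comb_pos (S : Geometry) {x y : R3} (hx : x ∈ S.surface) (hy : y ∈ S.surface)
    (hxy : 0 < S.polar x y) {α β : ℝ} (hα : 0 ≤ α) (hβ : 0 < β) :
    0 < S.polar (α • x + β • y) (α • x + β • y) ∧
      (S = .spherical ∨ 0 < (α • x + β • y) 2) := by
  refine ⟨?_, ?_⟩
  · rw [S.polar_comb hx hy]; positivity
  · rcases ((S.mem_surface_iff x).1 hx).2 with h | h
    · exact Or.inl h
    rcases ((S.mem_surface_iff y).1 hy).2 with h2 | h2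
    · exact Or.inl h2
    right
    simp only [Pi.add_apply, Pi.smul_apply, smul_eq_mul]
    positivity

/-! ### Convex arcs -/

theorem exists_slope_eq {f f' : ℝ → ℝ} {ε : ℝ}
    (h : ∀ s ∈ Set.Ioo (-ε) ε, HasDerivAt f (f' s) s) {a b : ℝ} (ha : a ∈ Set.Ioo (-ε) ε)
    (hb : b ∈ Set.Ioo (-ε) ε) (hab : a < b) :
    ∃ ξ ∈ Set.Ioo (-ε) ε, a < ξ ∧ ξ < b ∧ f b - f a = f' ξ * (b - a) := by
  have hJ : ∀ s ∈ Set.Icc a b, s ∈ Set.Ioo (-ε) ε := fun s hs =>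
    ⟨ha.1.trans_le hs.1, hs.2.trans_lt hb.2⟩
  obtain ⟨ξ, hξ, he⟩ := exists_hasDerivAt_eq_slope f f' hab
    (fun s hs => (h s (hJ s hs)).continuousAt.continuousWithinAt)
    (fun s hs => h s (hJ s (Set.Ioo_subset_Icc_self hs)))
  refine ⟨ξ, hJ ξ (Set.Ioo_subset_Icc_self hξ), hξ.1, hξ.2, ?_⟩
  rw [he, div_mul_cancel₀]
  exact (sub_pos.2 hab).ne'

/-- An arc `c` of the surface with derivatives `c₁`, `c₂`, parametrized by `(-ε, ε)` and so short
that `det (c, c₁, c₂)` keeps the sign `η` even when its three columns are taken at different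
parameters, and that `S.polar` is positive on its points (on the sphere: their distance is less than `π / 2`). -/
structure ConvexArc (S : Geometry) (η ε : ℝ) (c c₁ c₂ : ℝ → R3) : Prop where
  abs_eta : |η| = 1
  mem : ∀ s ∈ Set.Ioo (-ε) ε, c s ∈ S.surface
  hasDerivAt : ∀ s ∈ Set.Ioo (-ε) ε, HasDerivAt c (c₁ s) s
  hasDerivAt₁ : ∀ s ∈ Set.Ioo (-ε) ε, HasDerivAt c₁ (c₂ s) s
  pos : ∀ r ∈ Set.Ioo (-ε) ε, ∀ s ∈ Set.Ioo (-ε) ε, ∀ u ∈ Set.Ioo (-ε) ε,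
    0 < η * triple (c r) (c₁ s) (c₂ u)
  polar_pos : ∀ r ∈ Set.Ioo (-ε) ε, ∀ s ∈ Set.Ioo (-ε) ε, 0 < S.polar (c r) (c s)

namespace ConvexArc

variable {S : Geometry} {η ε : ℝ} {c c₁ c₂ : ℝ → R3}

theorem eta_ne_zero (h : ConvexArc S η ε c c₁ c₂) : η ≠ 0 := fun h0 => by
  have := h.abs_eta
  simp [h0] at this

theorem reverse (h : ConvexArc S η ε c c₁ c₂) :
    ConvexArc S (-η) ε (fun s => c (-s)) (fun s => -c₁ (-s)) (fun s => c₂ (-s)) := by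
  have hn : ∀ s ∈ Set.Ioo (-ε) ε, -s ∈ Set.Ioo (-ε) ε := fun s hs => by
    constructor <;> linarith [hs.1, hs.2]
  refine ⟨by rw [abs_neg, h.abs_eta], fun s hs => h.mem _ (hn s hs), fun s hs => ?_, fun s hs => ?_,
    fun r hr s hs u hu => ?_, fun r hr s hs => h.polar_pos _ (hn r hr) _ (hn s hs)⟩
  · simpa using! (h.hasDerivAt _ (hn s hs)).scomp s (hasDerivAt_neg s)
  · simpa using! ((h.hasDerivAt₁ _ (hn s hs)).scomp s (hasDerivAt_neg s)).neg
  · have := h.pos _ (hn r hr) _ (hn s hs) _ (hn u hu)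
    have e : triple (c (-r)) (-c₁ (-s)) (c₂ (-u)) = -triple (c (-r)) (c₁ (-s)) (c₂ (-u)) := by
      simp [triple]; ring
    rw [e]; linarith

/-- The arc lies strictly on one side of each of its tangent geodesics. -/
theorem tangent_pos (h : ConvexArc S η ε c c₁ c₂) {s u : ℝ} (hs : s ∈ Set.Ioo (-ε) ε)
    (hu : u ∈ Set.Ioo (-ε) ε) (hsu : u ≠ s) : 0 < η * triple (c s) (c₁ s) (c u) := by
  have d1 : ∀ v ∈ Set.Ioo (-ε) ε, HasDerivAt (fun u => η * triple (c s) (c₁ s) (c u))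
      (η * triple (c s) (c₁ s) (c₁ v)) v := fun v hv =>
    (hasDerivAt_triple_third (h.hasDerivAt v hv) _ _).const_mul η
  have d2 : ∀ v ∈ Set.Ioo (-ε) ε, HasDerivAt (fun u => η * triple (c s) (c₁ s) (c₁ u))
      (η * triple (c s) (c₁ s) (c₂ v)) v := fun v hv =>
    (hasDerivAt_triple_third (h.hasDerivAt₁ v hv) _ _).const_mul η
  rcases lt_or_gt_of_ne hsu with hlt | hlt
  · obtain ⟨ξ, hξ, h1, h2, e⟩ := exists_slope_eq d1 hu hs hlt
    obtain ⟨ζ, hζ, -, -, e'⟩ := exists_slope_eq d2 hξ hs h2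
    have := h.pos s hs s hs ζ hζ
    simp only [triple_self_outer, triple_self_right, mul_zero, zero_sub] at e e'
    have h3 : 0 < -(η * triple (c s) (c₁ s) (c₁ ξ)) := by
      rw [e']; exact mul_pos this (sub_pos.2 h2)
    nlinarith [sub_pos.2 hlt]
  · obtain ⟨ξ, hξ, h1, h2, e⟩ := exists_slope_eq d1 hs hu hlt
    obtain ⟨ζ, hζ, -, -, e'⟩ := exists_slope_eq d2 hs hξ h1
    have := h.pos s hs s hs ζ hζ
    simp only [triple_self_outer, triple_self_right, mul_zero, sub_zero] at e e'
    rw [e, e']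
    exact mul_pos (mul_pos this (sub_pos.2 h1)) (sub_pos.2 hlt)

/-- Three points of the arc are never on one geodesic, and every such triple has the same
orientation. -/
theorem triple_pos (h : ConvexArc S η ε c c₁ c₂) {u v w : ℝ} (hu : u ∈ Set.Ioo (-ε) ε)
    (hw : w ∈ Set.Ioo (-ε) ε) (huv : u < v) (hvw : v < w) :
    0 < η * triple (c u) (c v) (c w) := by
  have hv : v ∈ Set.Ioo (-ε) ε := ⟨hu.1.trans huv, hvw.trans hw.2⟩
  -- the function `v ↦ η det (c u, c v, c w)` is strictly concave and vanishes at `u` and `w`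
  have hconc : ∀ ζ ∈ Set.Ioo (-ε) ε, η * triple (c u) (c₂ ζ) (c w) < 0 := by
    intro ζ hζ
    obtain ⟨ξ, hξ, -, -, e⟩ := exists_slope_eq (f := fun x => η * triple (c u) (c₂ ζ) (c x))
      (f' := fun x => η * triple (c u) (c₂ ζ) (c₁ x))
      (fun x hx => (hasDerivAt_triple_third (h.hasDerivAt x hx) _ _).const_mul η) hu hw (huv.trans hvw)
    have := h.pos u hu ξ hξ ζ hζ
    simp only [triple_self_outer, mul_zero, sub_zero, triple_swap (c u) (c₁ ξ)] at e
    rw [e]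
    nlinarith [sub_pos.2 (huv.trans hvw)]
  have d1 : ∀ x ∈ Set.Ioo (-ε) ε, HasDerivAt (fun x => η * triple (c u) (c x) (c w))
      (η * triple (c u) (c₁ x) (c w)) x := fun x hx =>
    (hasDerivAt_triple_second (h.hasDerivAt x hx) _ _).const_mul η
  have d2 : ∀ x ∈ Set.Ioo (-ε) ε, HasDerivAt (fun x => η * triple (c u) (c₁ x) (c w))
      (η * triple (c u) (c₂ x) (c w)) x := fun x hx =>
    (hasDerivAt_triple_second (h.hasDerivAt₁ x hx) _ _).const_mul η
  obtain ⟨ξ, hξ, -, h2, e⟩ := exists_slope_eq d1 hu hv huv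
  obtain ⟨ξ', hξ', h3, -, e'⟩ := exists_slope_eq d1 hv hw hvw
  obtain ⟨ζ, hζ, -, -, e''⟩ := exists_slope_eq d2 hξ hξ' (h2.trans h3)
  have h4 := hconc ζ hζ
  simp only [triple_self_left, triple_self_right, mul_zero, sub_zero, zero_sub] at e e'
  have h5 := mul_neg_of_neg_of_pos h4 (sub_pos.2 (h2.trans h3))
  rw [← e''] at h5
  by_contra hn
  have h6 : 0 ≤ η * triple (c u) (c₁ ξ') (c w) := by
    by_contra h7
    nlinarith [mul_pos_of_neg_of_neg (not_le.1 h7) (neg_neg_of_pos (sub_pos.2 hvw))]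
  have h8 : η * triple (c u) (c₁ ξ) (c w) ≤ 0 := by
    by_contra h7
    nlinarith [mul_pos (not_le.1 h7) (sub_pos.2 huv)]
  linarith

end ConvexArc

/-! ### The area of a sector and the fan decomposition of a cap -/

/-- The largest `α` with `α² + β² + 2σαβ ≤ 1`. -/
noncomputable def sectorHeight (σ β : ℝ) : ℝ := Real.sqrt (1 - β ^ 2 + (σ * β) ^ 2) - σ * β

/-- The moment `∫∫ β dα dβ` of the sector `α, β ≥ 0`, `α² + β² + 2σαβ ≤ 1`. -/
noncomputable def sectorMoment (σ : ℝ) : ℝ := ∫ β in (0 : ℝ)..1, β * sectorHeight σ β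

theorem continuous_sectorHeight : Continuous fun v : ℝ × ℝ => sectorHeight v.1 v.2 := by
  unfold sectorHeight; fun_prop

theorem sectorHeight_nonneg {σ β : ℝ} (hβ : 0 ≤ β) (hβ1 : β ≤ 1) : 0 ≤ sectorHeight σ β := by
  refine sub_nonneg.2 (Real.le_sqrt_of_sq_le ?_)
  nlinarith

theorem le_sectorHeight_iff {σ α β : ℝ} (hσ : 0 < σ) (hα : 0 ≤ α) (hβ : 0 ≤ β) :
    α ≤ sectorHeight σ β ∧ β ≤ 1 ↔ α ^ 2 + β ^ 2 + 2 * σ * α * β ≤ 1 := by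
  have h0 : 0 ≤ σ * β := by positivity
  rw [sectorHeight, le_sub_iff_add_le]
  constructor
  · rintro ⟨h1, h2⟩
    have h3 : 0 ≤ 1 - β ^ 2 + (σ * β) ^ 2 := by nlinarith
    rw [Real.le_sqrt (by positivity)] at h1
    · nlinarith
    · exact h3
  · intro h
    refine ⟨Real.le_sqrt_of_sq_le (by nlinarith), ?_⟩
    have : 0 ≤ α * (σ * β) := by positivity
    nlinarith [sq_nonneg α]

theorem continuous_sectorMoment : Continuous sectorMoment := by
  unfold sectorMoment
  refine intervalIntegral.continuous_parametric_intervalIntegral_of_continuous' ?_ 0 1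
  exact continuous_snd.mul continuous_sectorHeight

theorem sectorMoment_pos (σ : ℝ) : 0 < sectorMoment σ := by
  refine intervalIntegral.intervalIntegral_pos_of_pos_on ?_ ?_ one_pos
  · exact (continuous_id.mul (continuous_sectorHeight.comp
      (continuous_const.prodMk continuous_id))).intervalIntegrable 0 1
  · rintro β ⟨h0, h1⟩
    refine mul_pos h0 (sub_pos.2 (Real.lt_sqrt_of_sq_lt ?_))
    nlinarith

/-- The domain of the fan parametrization `(s, β, α) ↦ α c(a) + β c(s)`. -/
def fanDomain (σ : ℝ → ℝ) (a b : ℝ) : Set R3 :=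
  {v | v 0 ∈ Set.Ioc a b ∧ v 1 ∈ Set.Ioc (0 : ℝ) 1 ∧ v 2 ∈ Set.Icc 0 (sectorHeight (σ (v 0)) (v 1))}

theorem measurableSet_fanDomain {σ : ℝ → ℝ} (hσ : Continuous σ) (a b : ℝ) :
    MeasurableSet (fanDomain σ a b) := by
  have h : Continuous fun v : R3 => sectorHeight (σ (v 0)) (v 1) :=
    continuous_sectorHeight.comp ((hσ.comp (continuous_apply 0)).prodMk (continuous_apply 1))
  refine (measurableSet_Ioc.preimage (measurable_pi_apply 0)).inter
    ((measurableSet_Ioc.preimage (measurable_pi_apply 1)).inter ?_)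
  exact (measurableSet_le measurable_const (measurable_pi_apply 2)).inter
    (measurableSet_le (measurable_pi_apply 2) h.measurable)

theorem lintegral_fanDomain {σ D : ℝ → ℝ} (hσ : Continuous σ) (hD : Continuous D)
    (hD0 : ∀ s, 0 ≤ D s) {a b : ℝ} (hab : a ≤ b) :
    ∫⁻ v in fanDomain σ a b, ENNReal.ofReal (v 1 * D (v 0)) =
      ENNReal.ofReal (∫ s in a..b, sectorMoment (σ s) * D s) := by
  let e : R3 ≃ᵐ ℝ × ℝ × ℝ := (MeasurableEquiv.piFinSuccAbove (fun _ : Fin 3 => ℝ) 0).trans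
    ((MeasurableEquiv.refl ℝ).prodCongr MeasurableEquiv.finTwoArrow)
  have he : MeasureTheory.MeasurePreserving e :=
    ((MeasureTheory.MeasurePreserving.id _).prod
      (MeasureTheory.volume_preserving_finTwoArrow ℝ)).comp
      (MeasureTheory.volume_preserving_piFinSuccAbove (fun _ : Fin 3 => ℝ) 0)
  have hev : ∀ v, e v = (v 0, v 1, v 2) := fun v => rfl
  let T : Set (ℝ × ℝ × ℝ) := {z | z.1 ∈ Set.Ioc a b ∧ z.2.1 ∈ Set.Ioc (0 : ℝ) 1 ∧
    z.2.2 ∈ Set.Icc 0 (sectorHeight (σ z.1) z.2.1)}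
  have hT : fanDomain σ a b = e ⁻¹' T := by
    ext v; simp [fanDomain, T, hev]
  have hH : Continuous fun z : ℝ × ℝ × ℝ => sectorHeight (σ z.1) z.2.1 :=
    continuous_sectorHeight.comp
      ((hσ.comp continuous_fst).prodMk (continuous_fst.comp continuous_snd))
  have hTm : MeasurableSet T := by
    refine (measurableSet_Ioc.preimage measurable_fst).inter
      ((measurableSet_Ioc.preimage (measurable_fst.comp measurable_snd)).inter ?_)
    exact (measurableSet_le measurable_const (measurable_snd.comp measurable_snd)).inter
      (measurableSet_le (measurable_snd.comp measurable_snd) hH.measurable)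
  have hf : Continuous fun z : ℝ × ℝ × ℝ => ENNReal.ofReal (z.2.1 * D z.1) :=
    ENNReal.continuous_ofReal.comp
      ((continuous_fst.comp continuous_snd).mul (hD.comp continuous_fst))
  have h1 : ∫⁻ v in fanDomain σ a b, ENNReal.ofReal (v 1 * D (v 0)) =
      ∫⁻ z in T, ENNReal.ofReal (z.2.1 * D z.1) := by
    rw [hT]
    exact he.setLIntegral_comp_preimage_emb e.measurableEmbedding
      (fun z : ℝ × ℝ × ℝ => ENNReal.ofReal (z.2.1 * D z.1)) T
  rw [h1, ← MeasureTheory.lintegral_indicator hTm, MeasureTheory.Measure.volume_eq_prod,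
    MeasureTheory.lintegral_prod _ (hf.measurable.indicator hTm).aemeasurable]
  have hin : ∀ s, ∫⁻ w : ℝ × ℝ, T.indicator (fun z => ENNReal.ofReal (z.2.1 * D z.1)) (s, w) =
      (Set.Ioc a b).indicator (fun s => ENNReal.ofReal (sectorMoment (σ s) * D s)) s := by
    intro s
    by_cases hs : s ∈ Set.Ioc a b
    swap
    · rw [Set.indicator_of_notMem hs]
      have : ∀ w : ℝ × ℝ, T.indicator (fun z => ENNReal.ofReal (z.2.1 * D z.1)) (s, w) = 0 :=
        fun w => Set.indicator_of_notMem (fun h => hs h.1) _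
      simp [this]
    rw [Set.indicator_of_mem hs, MeasureTheory.Measure.volume_eq_prod,
      MeasureTheory.lintegral_prod
        (fun w : ℝ × ℝ => T.indicator (fun z => ENNReal.ofReal (z.2.1 * D z.1)) (s, w))
        ((hf.measurable.indicator hTm).comp measurable_prodMk_left).aemeasurable]
    have hin2 : ∀ β, ∫⁻ α : ℝ, T.indicator (fun z => ENNReal.ofReal (z.2.1 * D z.1)) (s, β, α) =
        (Set.Ioc (0 : ℝ) 1).indicator
          (fun β => ENNReal.ofReal (β * sectorHeight (σ s) β * D s)) β := by
      intro β
      by_cases hβ : β ∈ Set.Ioc (0 : ℝ) 1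
      swap
      · rw [Set.indicator_of_notMem hβ]
        have : ∀ α : ℝ, T.indicator (fun z => ENNReal.ofReal (z.2.1 * D z.1)) (s, β, α) = 0 :=
          fun w => Set.indicator_of_notMem (fun h => hβ h.2.1) _
        simp [this]
      rw [Set.indicator_of_mem hβ]
      have : ∀ α : ℝ, T.indicator (fun z => ENNReal.ofReal (z.2.1 * D z.1)) (s, β, α) =
          (Set.Icc 0 (sectorHeight (σ s) β)).indicator
            (fun _ => ENNReal.ofReal (β * D s)) α := by
        intro α
        by_cases hα : α ∈ Set.Icc 0 (sectorHeight (σ s) β)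
        · rw [Set.indicator_of_mem hα, Set.indicator_of_mem (show (s, β, α) ∈ T from ⟨hs, hβ, hα⟩)]
        · rw [Set.indicator_of_notMem hα, Set.indicator_of_notMem (fun h => hα h.2.2)]
      simp only [this]
      rw [MeasureTheory.lintegral_indicator measurableSet_Icc, MeasureTheory.setLIntegral_const,
        Real.volume_Icc, sub_zero, ← ENNReal.ofReal_mul (mul_nonneg hβ.1.le (hD0 s))]
      congr 1; ring
    simp only [hin2]
    have hc : Continuous fun β => β * sectorHeight (σ s) β * D s :=
      (continuous_id.mul (continuous_sectorHeight.comp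
        (continuous_const.prodMk continuous_id))).mul continuous_const
    rw [MeasureTheory.lintegral_indicator measurableSet_Ioc,
      ← MeasureTheory.ofReal_integral_eq_lintegral_ofReal,
      ← intervalIntegral.integral_of_le zero_le_one, intervalIntegral.integral_mul_const]
    · rfl
    · exact (hc.intervalIntegrable (μ := MeasureTheory.volume) 0 1).1
    · refine (MeasureTheory.ae_restrict_iff' measurableSet_Ioc).2 (Eventually.of_forall ?_)
      intro β hβ
      exact mul_nonneg (mul_nonneg hβ.1.le (sectorHeight_nonneg hβ.1.le hβ.2)) (hD0 s)
  simp only [hin]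
  have hc : Continuous fun s => sectorMoment (σ s) * D s :=
    (continuous_sectorMoment.comp hσ).mul hD
  rw [MeasureTheory.lintegral_indicator measurableSet_Ioc,
    ← MeasureTheory.ofReal_integral_eq_lintegral_ofReal,
    ← intervalIntegral.integral_of_le hab]
  · exact (hc.intervalIntegrable (μ := MeasureTheory.volume) a b).1
  · exact Eventually.of_forall fun s => mul_nonneg (sectorMoment_pos _).le (hD0 s)

theorem le_of_mem_convexHull {X : Set R3} {x y z : R3} {η : ℝ}
    (h : ∀ p ∈ X, 0 ≤ η * triple x y p) (hz : z ∈ convexHull ℝ X) : 0 ≤ η * triple x y z := by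
  have hc : Convex ℝ {p : R3 | 0 ≤ η * triple x y p} := by
    intro p hp q hq α β hα hβ _
    simp only [Set.mem_ofPred_eq, triple_add_smul_third] at *
    nlinarith [mul_nonneg hα hp, mul_nonneg hβ hq]
  exact convexHull_min h hc hz

namespace ConvexArc

variable {S : Geometry} {η ε : ℝ} {c c₁ c₂ : ℝ → R3}

theorem continuousAt (h : ConvexArc S η ε c c₁ c₂) {s : ℝ} (hs : s ∈ Set.Ioo (-ε) ε) :
    ContinuousAt c s := (h.hasDerivAt s hs).continuousAt

theorem continuousAt₁ (h : ConvexArc S η ε c c₁ c₂) {s : ℝ} (hs : s ∈ Set.Ioo (-ε) ε) :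
    ContinuousAt c₁ s := (h.hasDerivAt₁ s hs).continuousAt

/-- Every point of the convex hull of a subarc lies on a chord issued from its first endpoint. -/
theorem exists_chord (h : ConvexArc S η ε c c₁ c₂) {a b : ℝ} (ha : a ∈ Set.Ioo (-ε) ε)
    (hb : b ∈ Set.Ioo (-ε) ε) (hab : a < b) {z : R3} (hz : z ∈ convexHull ℝ (c '' Set.Icc a b)) :
    z ∈ Submodule.span ℝ {c a} ∨
      ∃ s ∈ Set.Ioc a b, ∃ α β : ℝ, 0 ≤ α ∧ 0 < β ∧ z = α • c a + β • c s := by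
  have hJ : ∀ s ∈ Set.Icc a b, s ∈ Set.Ioo (-ε) ε := fun s hs =>
    ⟨ha.1.trans_le hs.1, hs.2.trans_lt hb.2⟩
  -- the tangent form at `a` vanishes on the arc only at `a`, so the points where it is positive
  -- form, together with the line through `c a`, a convex set that contains the arc
  have hT : z ∈ {p : R3 | 0 < η * triple (c a) (c₁ a) p} ∪ (Submodule.span ℝ {c a} : Set R3) := by
    have hk : ∀ p ∈ Submodule.span ℝ {c a}, triple (c a) (c₁ a) p = 0 := by
      intro p hp
      obtain ⟨r, rfl⟩ := Submodule.mem_span_singleton.1 hp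
      have := triple_add_smul_third (c a) (c₁ a) (c a) 0 r 0
      simpa [triple_self_outer] using this
    refine convexHull_min ?_ ?_ hz
    · rintro _ ⟨s, hs, rfl⟩
      rcases eq_or_ne s a with rfl | hne
      · exact Or.inr (Submodule.mem_span_singleton_self _)
      · exact Or.inl (h.tangent_pos ha (hJ s hs) hne)
    · intro p hp q hq α β hα hβ hαβ
      rcases hα.eq_or_lt with rfl | hα'
      · rw [zero_add] at hαβ; simpa [hαβ] using hq
      rcases hβ.eq_or_lt with rfl | hβ'
      · rw [add_zero] at hαβ; simpa [hαβ] using hp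
      rcases hp with hp | hp <;> rcases hq with hq | hq
      · left
        simp only [Set.mem_ofPred_eq, triple_add_smul_third] at *
        nlinarith [mul_pos hα' hp, mul_pos hβ' hq]
      · left
        simp only [Set.mem_ofPred_eq, triple_add_smul_third, hk q hq] at *
        nlinarith [mul_pos hα' hp]
      · left
        simp only [Set.mem_ofPred_eq, triple_add_smul_third, hk p hp] at *
        nlinarith [mul_pos hβ' hq]
      · exact Or.inr (add_mem (Submodule.smul_mem _ _ hp) (Submodule.smul_mem _ _ hq))
  rcases hT with hpos | hspan
  swap
  · exact Or.inl hspan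
  right
  simp only [Set.mem_ofPred_eq] at hpos
  -- `s` is a zero of `ψ`, which is positive near `a` and nonpositive at `b`
  let ψ : ℝ → ℝ := fun s => η * triple (c a) (c s) z
  have hψb : ψ b ≤ 0 := by
    have : 0 ≤ (-η) * triple (c a) (c b) z := by
      refine le_of_mem_convexHull ?_ hz
      rintro _ ⟨u, hu, rfl⟩
      rcases hu.1.eq_or_lt with rfl | h1
      · simp [triple_self_outer]
      rcases hu.2.eq_or_lt with rfl | h2
      · simp [triple_self_right]
      have := h.triple_pos ha hb h1 h2
      rw [triple_swap]; linarith
    simp only [ψ]; linarith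
  have hψa : HasDerivAt ψ (η * triple (c a) (c₁ a) z) a :=
    (hasDerivAt_triple_second (h.hasDerivAt a ha) _ _).const_mul η
  have hψ0 : ψ a = 0 := by simp [ψ, triple_self_left]
  obtain ⟨a', ⟨ha'1, ha'2⟩, ha'⟩ : ∃ a' ∈ Set.Ioo a b, 0 < ψ a' := by
    have h1 := (hasDerivAt_iff_tendsto_slope.1 hψa).eventually (lt_mem_nhds hpos)
    have h2 := h1.filter_mono (nhdsWithin_mono a (fun x (hx : x ∈ Set.Ioi a) => ne_of_gt hx))
    obtain ⟨x, hx, hx'⟩ := (h2.and (Ioo_mem_nhdsGT hab)).exists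
    refine ⟨x, hx', ?_⟩
    rw [slope_def_field, hψ0, sub_zero] at hx
    exact (div_pos_iff_of_pos_right (sub_pos.2 hx'.1)).1 hx
  obtain ⟨s, hs, hs0⟩ : ∃ s ∈ Set.Icc a' b, ψ s = 0 := by
    have hc : ContinuousOn ψ (Set.Icc a' b) := fun s hs =>
      ((hasDerivAt_triple_second (h.hasDerivAt s (hJ s ⟨ha'1.le.trans hs.1, hs.2⟩)) (c a) z).const_mul
        η).continuousAt.continuousWithinAt
    exact intermediate_value_Icc' ha'2.le hc ⟨hψb, ha'.le⟩
  have hsab : s ∈ Set.Ioc a b := ⟨ha'1.trans_le hs.1, hs.2⟩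
  have hsJ := hJ s (Set.Ioc_subset_Icc_self hsab)
  have hη := h.eta_ne_zero
  have hz0 : triple (c a) (c s) z = 0 := (mul_eq_zero.1 hs0).resolve_left hη
  have hd := h.tangent_pos hsJ ha hsab.1.ne
  have hd' : 0 < η * triple (c a) (c s) (c₁ s) := by rwa [triple_rotate]
  have hd0 : triple (c a) (c s) (c₁ s) ≠ 0 := fun h0 => by simp [h0] at hd'
  have hexp : z = (triple z (c s) (c₁ s) / triple (c a) (c s) (c₁ s)) • c a +
      (triple (c a) z (c₁ s) / triple (c a) (c s) (c₁ s)) • c s := by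
    have := triple_smul_eq (c a) (c s) (c₁ s) z
    rw [hz0, zero_smul, add_zero] at this
    rw [div_eq_inv_mul, div_eq_inv_mul, mul_smul, mul_smul, ← smul_add, ← this, smul_smul,
      inv_mul_cancel₀ hd0, one_smul]
  refine ⟨s, hsab, _, _, ?_, ?_, hexp⟩
  -- the coefficient of `c a` has the sign of the tangent form at `s`, that of `c s` has the sign of
  -- the tangent form at `a`
  · rw [← mul_div_mul_left _ _ hη]
    refine div_nonneg ?_ hd'.le
    rw [triple_rotate]
    refine le_of_mem_convexHull ?_ hz
    rintro _ ⟨u, hu, rfl⟩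
    rcases eq_or_ne u s with rfl | hne
    · simp [triple_self_outer]
    · exact (h.tangent_pos hsJ (hJ u hu) hne).le
  · have h2 := h.tangent_pos ha hsJ hsab.1.ne'
    have h3 := hpos
    rw [hexp, triple_add_smul_third, triple_self_outer, mul_zero, zero_add, mul_left_comm] at h3
    exact pos_of_mul_pos_left h3 h2.le

end ConvexArc

/-- The density of the area of the cap in the fan of chords issued from the point of parameter
`a`: its integral over the parameter of the other endpoint is the area. -/
noncomputable def Geometry.fanDensity (S : Geometry) (η : ℝ) (c c₁ : ℝ → R3)
    (a s : ℝ) : ℝ :=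
  3 * sectorMoment (S.polar (c a) (c s)) * (η * triple (c a) (c s) (c₁ s))

namespace ConvexArc

variable {S : Geometry} {η ε : ℝ} {c c₁ c₂ : ℝ → R3}

theorem fanDensity_pos (h : ConvexArc S η ε c c₁ c₂) {a s : ℝ} (ha : a ∈ Set.Ioo (-ε) ε)
    (hs : s ∈ Set.Ioo (-ε) ε) (has : a ≠ s) : 0 < S.fanDensity η c c₁ a s := by
  have := h.tangent_pos hs ha has
  rw [triple_rotate, triple_rotate] at this
  exact mul_pos (mul_pos three_pos (sectorMoment_pos _)) this

/-- The area of a cap, computed by the change of variables `(s, β, α) ↦ α c(a) + β c(s)` in the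
cone over the cap. -/
theorem area_cap (h : ConvexArc S η ε c c₁ c₂) {a b : ℝ} (ha : a ∈ Set.Ioo (-ε) ε)
    (hb : b ∈ Set.Ioo (-ε) ε) (hab : a < b) :
    area (S.cap c a b) = ENNReal.ofReal (∫ s in a..b, S.fanDensity η c c₁ a s) := by
  have hJ : ∀ s ∈ Set.Icc a b, s ∈ Set.Ioo (-ε) ε := fun s hs =>
    ⟨ha.1.trans_le hs.1, hs.2.trans_lt hb.2⟩
  -- the parameter is clamped to `[a, b]`, so that the functions below are continuous on `ℝ`
  let cl : ℝ → ℝ := fun s => max a (min b s)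
  have hcl : Continuous cl := continuous_const.max (continuous_const.min continuous_id)
  have hclm : ∀ s, cl s ∈ Set.Icc a b := fun s => ⟨le_max_left _ _, max_le hab.le (min_le_left _ _)⟩
  have hcle : ∀ s ∈ Set.Icc a b, cl s = s := fun s hs => by
    simp only [cl]; rw [min_eq_right hs.2, max_eq_right hs.1]
  have hcc : Continuous fun s => c (cl s) := continuous_iff_continuousAt.2 fun s =>
    (h.continuousAt (hJ _ (hclm s))).comp (f := cl) hcl.continuousAt
  have hcc₁ : Continuous fun s => c₁ (cl s) := continuous_iff_continuousAt.2 fun s =>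
    (h.continuousAt₁ (hJ _ (hclm s))).comp (f := cl) hcl.continuousAt
  let σ : ℝ → ℝ := fun s => S.polar (c a) (c (cl s))
  let D : ℝ → ℝ := fun s => |triple (c a) (c (cl s)) (c₁ (cl s))|
  have hσ : Continuous σ := S.continuous_polar.comp (continuous_const.prodMk hcc)
  have hD : Continuous D :=
    (continuous_triple.comp (continuous_const.prodMk (hcc.prodMk hcc₁))).abs
  have hσ0 : ∀ s, 0 < σ s := fun s => h.polar_pos _ ha _ (hJ _ (hclm s))
  have hd : ∀ s ∈ Set.Ioc a b, 0 < η * triple (c a) (c s) (c₁ s) := fun s hs => by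
    have := h.tangent_pos (hJ s (Set.Ioc_subset_Icc_self hs)) ha hs.1.ne
    rwa [triple_rotate]
  have hd0 : ∀ s ∈ Set.Ioc a b, triple (c a) (c s) (c₁ s) ≠ 0 := fun s hs h0 => by
    have := hd s hs
    simp [h0] at this
  let F : R3 → R3 := fun v => v 2 • c a + v 1 • c (v 0)
  let pr : Fin 3 → R3 →L[ℝ] ℝ := fun i => ContinuousLinearMap.proj (R := ℝ) (φ := fun _ : Fin 3 => ℝ) i
  let F' : R3 → R3 →L[ℝ] R3 := fun v =>
    (pr 2).smulRight (c a) + (v 1 • (pr 0).smulRight (c₁ (v 0)) + (pr 1).smulRight (c (v 0)))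
  let E := fanDomain σ a b
  have hF' : ∀ v ∈ E, HasFDerivWithinAt F (F' v) E v := by
    intro v hv
    have h0 : HasFDerivAt (fun w : R3 => c (w 0)) ((pr 0).smulRight (c₁ (v 0))) v := by
      have := (h.hasDerivAt (v 0) (hJ _ (Set.Ioc_subset_Icc_self hv.1))).hasFDerivAt.comp v
        ((pr 0).hasFDerivAt (x := v))
      refine (show HasFDerivAt (fun w : R3 => c (w 0)) _ v from this).congr_fderiv ?_
      ext w i; simp
    exact (((pr 2).hasFDerivAt (x := v)).smul_const (c a)
      |>.add (((pr 1).hasFDerivAt (x := v)).smul h0)).hasFDerivWithinAt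
  have hFi : Set.InjOn F E := by
    have key : ∀ v ∈ E, ∀ w ∈ E, F v = F w → ¬ v 0 < w 0 := by
      intro v hv w hw he hlt
      have h1 := congrArg (triple (c a) (c (v 0))) he
      simp only [F, triple_add_smul_third, triple_self_outer, triple_self_right, mul_zero,
        zero_add] at h1
      have h2 := h.triple_pos ha (hJ _ (Set.Ioc_subset_Icc_self hw.1)) hv.1.1 hlt
      rcases mul_eq_zero.1 h1.symm with h3 | h3
      · exact hw.2.1.1.ne' h3
      · simp [h3] at h2
    intro v hv w hw he
    have h0 : v 0 = w 0 :=
      le_antisymm (not_lt.1 (key w hw v hv he.symm)) (not_lt.1 (key v hv w hw he))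
    have hne := hd0 _ hv.1
    have h1 : v 1 = w 1 := by
      have h1 := congrArg (triple (c₁ (v 0)) (c a)) he
      simp only [F, triple_add_smul_third, triple_self_right, mul_zero, zero_add, ← h0] at h1
      rw [triple_rotate] at h1
      exact mul_right_cancel₀ hne h1
    have h2 : v 2 = w 2 := by
      have h2 := congrArg (triple (c (v 0)) (c₁ (v 0))) he
      simp only [F, triple_add_smul_third, triple_self_outer, mul_zero, add_zero, ← h0] at h2
      rw [← triple_rotate] at h2
      exact mul_right_cancel₀ hne h2
    ext i; fin_cases i
    exacts [h0, h1, h2]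
  have hdet : ∀ v ∈ E, |(F' v).det| = v 1 * D (v 0) := by
    intro v hv
    have h1 : (F' v).det = -(v 1 * triple (c a) (c (v 0)) (c₁ (v 0))) := by
      have h0 : (F' v).det = Matrix.det (LinearMap.toMatrix' (F' v : R3 →ₗ[ℝ] R3)) :=
        (LinearMap.det_toMatrix' _).symm
      have hm : LinearMap.toMatrix' (F' v : R3 →ₗ[ℝ] R3) =
          Matrix.of fun i j => F' v (Pi.single j 1) i := by
        ext i j
        rw [LinearMap.toMatrix'_apply]
        rfl
      rw [h0, hm, Matrix.det_fin_three]
      simp [F', pr, triple]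
      ring
    rw [h1, abs_neg, abs_mul, abs_of_pos hv.2.1.1]
    simp only [D, hcle _ (Set.Ioc_subset_Icc_self hv.1)]
  -- the cone over the cap is the image of the fan domain, up to points of the line through `c a`
  have hsub1 : F '' E ⊆ {y : R3 | ∃ r ∈ Set.Ioc (0 : ℝ) 1, ∃ x ∈ S.cap c a b, y = r • x} := by
    rintro _ ⟨v, hv, rfl⟩
    have hs := hJ _ (Set.Ioc_subset_Icc_self hv.1)
    have hα : 0 ≤ v 2 := hv.2.2.1
    have hβ : 0 < v 1 := hv.2.1.1
    obtain ⟨hp, hp'⟩ := S.comb_pos (h.mem a ha) (h.mem _ hs) (h.polar_pos a ha _ hs) hα hβ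
    have hσe : σ (v 0) = S.polar (c a) (c (v 0)) := by
      simp only [σ, hcle _ (Set.Ioc_subset_Icc_self hv.1)]
    have hle : S.polar (F v) (F v) ≤ 1 := by
      rw [S.polar_comb (h.mem a ha) (h.mem _ hs), ← hσe]
      exact (le_sectorHeight_iff (hσ0 _) hα hβ.le).1 ⟨hv.2.2.2, hv.2.1.2⟩
    have hr := Real.sqrt_pos.2 hp
    refine ⟨Real.sqrt (S.polar (F v) (F v)), ⟨hr, Real.sqrt_le_one.2 hle⟩, S.normalize (F v),
      ⟨S.normalize_mem hp hp', Real.sqrt (S.polar (F v) (F v)) / (v 2 + v 1), by positivity, ?_⟩, ?_⟩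
    · have hsum : 0 < v 2 + v 1 := by positivity
      have e : (Real.sqrt (S.polar (F v) (F v)) / (v 2 + v 1)) • S.normalize (F v) =
          (v 2 / (v 2 + v 1)) • c a + (v 1 / (v 2 + v 1)) • c (v 0) := by
        rw [Geometry.normalize, smul_smul, div_mul_eq_mul_div, mul_inv_cancel₀ hr.ne']
        simp only [F, smul_add, smul_smul, div_eq_inv_mul, mul_one]
      rw [e]
      refine convex_convexHull ℝ _ (subset_convexHull ℝ _ (Set.mem_image_of_mem c (Set.left_mem_Icc.2 hab.le)))
        (subset_convexHull ℝ _ (Set.mem_image_of_mem c (Set.Ioc_subset_Icc_self hv.1)))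
        (by positivity) (by positivity) ?_
      rw [← add_div, div_self hsum.ne']
    · rw [Geometry.normalize, smul_smul, mul_inv_cancel₀ hr.ne', one_smul]
  have hsub2 : {y : R3 | ∃ r ∈ Set.Ioc (0 : ℝ) 1, ∃ x ∈ S.cap c a b, y = r • x} ⊆
      F '' E ∪ (Submodule.span ℝ {c a} : Set R3) := by
    rintro _ ⟨r, hr, x, ⟨hxS, ρ, hρ, hx⟩, rfl⟩
    have hrx : r • x = (r / ρ) • (ρ • x) := by rw [smul_smul, div_mul_cancel₀ _ hρ.ne']
    rcases h.exists_chord ha hb hab hx with hz | ⟨s, hs, α, β, hα, hβ, he⟩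
    · right; rw [hrx]; exact Submodule.smul_mem _ _ hz
    left
    have hs' := Set.Ioc_subset_Icc_self hs
    have hrρ : 0 < r / ρ := div_pos hr.1 hρ
    have he' : r • x = (r / ρ * α) • c a + (r / ρ * β) • c s := by
      rw [hrx, he, smul_add, smul_smul, smul_smul]
    have hq := S.polar_comb (h.mem a ha) (h.mem s (hJ s hs')) (r / ρ * α) (r / ρ * β)
    rw [← he', S.polar_smul_self, S.polar_self hxS, mul_one] at hq
    have hα' : 0 ≤ r / ρ * α := by positivity
    have hβ' : 0 < r / ρ * β := by positivity
    have hσe : σ s = S.polar (c a) (c s) := by simp only [σ, hcle _ hs']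
    have hle := (le_sectorHeight_iff (hσ0 s) hα' hβ'.le).2 (by
      rw [hσe, ← hq]; nlinarith [hr.1, hr.2])
    refine ⟨![s, r / ρ * β, r / ρ * α], ⟨hs, ⟨hβ', hle.2⟩, hα', hle.1⟩, ?_⟩
    rw [he']; rfl
  have hspan : MeasureTheory.volume (Submodule.span ℝ {c a} : Set R3) = 0 := by
    refine MeasureTheory.Measure.addHaar_submodule _ _ fun htop => ?_
    have := finrank_span_le_card (R := ℝ) ({c a} : Set R3)
    rw [htop, finrank_top] at this
    simp at this
  have hvol : MeasureTheory.volume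
      {y : R3 | ∃ r ∈ Set.Ioc (0 : ℝ) 1, ∃ x ∈ S.cap c a b, y = r • x} =
      MeasureTheory.volume (F '' E) := by
    refine le_antisymm ((MeasureTheory.measure_mono hsub2).trans ?_)
      (MeasureTheory.measure_mono hsub1)
    refine (MeasureTheory.measure_union_le _ _).trans ?_
    rw [hspan, add_zero]
  have hEm : MeasurableSet E := measurableSet_fanDomain hσ a b
  rw [area, hvol, ← MeasureTheory.setLIntegral_one,
    MeasureTheory.lintegral_image_eq_lintegral_abs_det_fderiv_mul _ hEm hF' hFi]
  have h1 : ∫⁻ v in E, ENNReal.ofReal |(F' v).det| * 1 =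
      ∫⁻ v in E, ENNReal.ofReal (v 1 * D (v 0)) :=
    MeasureTheory.setLIntegral_congr_fun hEm fun v hv => by simp only [hdet v hv, mul_one]
  rw [h1, lintegral_fanDomain hσ hD (fun s => abs_nonneg _) hab.le, ← ENNReal.ofReal_ofNat 3,
    ← ENNReal.ofReal_mul (by norm_num), ← intervalIntegral.integral_const_mul]
  congr 1
  refine intervalIntegral.integral_congr_uIoo fun s hs => ?_
  rw [Set.uIoo_of_le hab.le] at hs
  have hs' := Set.Ioo_subset_Icc_self hs
  simp only [Geometry.fanDensity, σ, D, hcle s hs']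
  rw [← abs_of_pos (hd s ⟨hs.1, hs.2.le⟩), abs_mul, h.abs_eta]
  ring

end ConvexArc

/-! ### The area of a cap as a function of its endpoints -/

/-- The area of the cap over `[a, b]`, as a real number. -/
noncomputable def Geometry.capArea (S : Geometry) (η : ℝ) (c c₁ : ℝ → R3)
    (a b : ℝ) : ℝ :=
  ∫ s in a..b, S.fanDensity η c c₁ a s

namespace ConvexArc

variable {S : Geometry} {η ε : ℝ} {c c₁ c₂ : ℝ → R3}

/-- The area of a cap computed in the fan of chords issued from its last endpoint, by
reversing the parameter. -/
theorem area_cap_right (h : ConvexArc S η ε c c₁ c₂) {a b : ℝ} (ha : a ∈ Set.Ioo (-ε) ε)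
    (hb : b ∈ Set.Ioo (-ε) ε) (hab : a < b) :
    area (S.cap c a b) = ENNReal.ofReal (∫ s in a..b, S.fanDensity η c c₁ b s) := by
  have h1 := h.reverse.area_cap (a := -b) (b := -a) ⟨by linarith [hb.2], by linarith [hb.1]⟩
    ⟨by linarith [ha.2], by linarith [ha.1]⟩ (neg_lt_neg hab)
  have h2 : S.cap (fun s => c (-s)) (-b) (-a) = S.cap c a b := by
    have : (fun s => c (-s)) '' Set.Icc (-b) (-a) = c '' Set.Icc a b := by
      rw [show (fun s => c (-s)) = c ∘ Neg.neg from rfl, Set.image_comp, Set.image_neg_eq_neg,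
        Set.neg_Icc, neg_neg, neg_neg]
    simp only [Geometry.cap, this]
  have h3 : ∀ s, S.fanDensity (-η) (fun s => c (-s)) (fun s => -c₁ (-s)) (-b) s =
      S.fanDensity η c c₁ b (-s) := by
    intro s
    have : triple (c b) (c (-s)) (-c₁ (-s)) = -triple (c b) (c (-s)) (c₁ (-s)) := by
      simp [triple]; ring
    simp only [Geometry.fanDensity, neg_neg, this, neg_mul_neg]
  rw [h2] at h1
  simp only [h3] at h1
  rw [intervalIntegral.integral_comp_neg (fun s => S.fanDensity η c c₁ b s), neg_neg, neg_neg] at h1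
  exact h1

theorem continuousAt_fanDensity (h : ConvexArc S η ε c c₁ c₂) {a b : ℝ} (ha : a ∈ Set.Ioo (-ε) ε)
    (hb : b ∈ Set.Ioo (-ε) ε) :
    ContinuousAt (fun v : ℝ × ℝ => S.fanDensity η c c₁ v.1 v.2) (a, b) := by
  have h1 : ContinuousAt (fun v : ℝ × ℝ => c v.1) (a, b) :=
    (h.continuousAt ha).comp (f := Prod.fst) continuousAt_fst
  have h2 : ContinuousAt (fun v : ℝ × ℝ => c v.2) (a, b) :=
    (h.continuousAt hb).comp (f := Prod.snd) (x := (a, b)) continuousAt_snd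
  have h3 : ContinuousAt (fun v : ℝ × ℝ => c₁ v.2) (a, b) :=
    (h.continuousAt₁ hb).comp (f := Prod.snd) (x := (a, b)) continuousAt_snd
  have h4 : ContinuousAt (fun v : ℝ × ℝ => S.polar (c v.1) (c v.2)) (a, b) :=
    S.continuous_polar.continuousAt.comp (h1.prodMk h2)
  have h5 : ContinuousAt (fun v : ℝ × ℝ => triple (c v.1) (c v.2) (c₁ v.2)) (a, b) :=
    continuous_triple.continuousAt.comp (h1.prodMk (h2.prodMk h3))
  exact (continuousAt_const.mul (continuous_sectorMoment.continuousAt.comp h4)).mul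
    (continuousAt_const.mul h5)

theorem continuousOn_fanDensity (h : ConvexArc S η ε c c₁ c₂) {a : ℝ} (ha : a ∈ Set.Ioo (-ε) ε) :
    ContinuousOn (S.fanDensity η c c₁ a) (Set.Ioo (-ε) ε) := fun _ hb =>
  ((h.continuousAt_fanDensity ha hb).comp (f := fun s => (a, s))
    (continuousAt_const.prodMk continuousAt_id)).continuousWithinAt

theorem intervalIntegrable_fanDensity (h : ConvexArc S η ε c c₁ c₂) {a x y : ℝ}
    (ha : a ∈ Set.Ioo (-ε) ε) (hx : x ∈ Set.Ioo (-ε) ε) (hy : y ∈ Set.Ioo (-ε) ε) :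
    IntervalIntegrable (S.fanDensity η c c₁ a) MeasureTheory.volume x y :=
  ((h.continuousOn_fanDensity ha).mono (Set.ordConnected_Ioo.uIcc_subset hx hy)).intervalIntegrable

theorem capArea_pos (h : ConvexArc S η ε c c₁ c₂) {a b : ℝ} (ha : a ∈ Set.Ioo (-ε) ε)
    (hb : b ∈ Set.Ioo (-ε) ε) (hab : a < b) : 0 < S.capArea η c c₁ a b :=
  intervalIntegral.intervalIntegral_pos_of_pos_on (h.intervalIntegrable_fanDensity ha ha hb)
    (fun _ hs => h.fanDensity_pos ha ⟨ha.1.trans hs.1, hs.2.trans hb.2⟩ hs.1.ne) hab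

theorem capArea_eq_right (h : ConvexArc S η ε c c₁ c₂) {a b : ℝ} (ha : a ∈ Set.Ioo (-ε) ε)
    (hb : b ∈ Set.Ioo (-ε) ε) (hab : a < b) :
    S.capArea η c c₁ a b = ∫ s in a..b, S.fanDensity η c c₁ b s := by
  have h1 := (h.area_cap ha hb hab).symm.trans (h.area_cap_right ha hb hab)
  refine (ENNReal.ofReal_eq_ofReal_iff (h.capArea_pos ha hb hab).le ?_).1 h1
  exact (intervalIntegral.intervalIntegral_pos_of_pos_on (h.intervalIntegrable_fanDensity hb ha hb)
    (fun _ hs => h.fanDensity_pos hb ⟨ha.1.trans hs.1, hs.2.trans hb.2⟩ hs.2.ne') hab).le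

theorem hasDerivAt_capArea_right (h : ConvexArc S η ε c c₁ c₂) {a b : ℝ}
    (ha : a ∈ Set.Ioo (-ε) ε) (hb : b ∈ Set.Ioo (-ε) ε) :
    HasDerivAt (S.capArea η c c₁ a) (S.fanDensity η c c₁ a b) b :=
  intervalIntegral.integral_hasDerivAt_right (h.intervalIntegrable_fanDensity ha ha hb)
    ((h.continuousOn_fanDensity ha).stronglyMeasurableAtFilter isOpen_Ioo b hb)
    ((h.continuousOn_fanDensity ha).continuousAt (isOpen_Ioo.mem_nhds hb))

theorem hasDerivAt_capArea_left (h : ConvexArc S η ε c c₁ c₂) {a b : ℝ}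
    (ha : a ∈ Set.Ioo (-ε) ε) (hb : b ∈ Set.Ioo (-ε) ε) (hab : a < b) :
    HasDerivAt (fun x => S.capArea η c c₁ x b) (-S.fanDensity η c c₁ b a) a := by
  refine (intervalIntegral.integral_hasDerivAt_left (h.intervalIntegrable_fanDensity hb ha hb)
    ((h.continuousOn_fanDensity hb).stronglyMeasurableAtFilter isOpen_Ioo a ha)
    ((h.continuousOn_fanDensity hb).continuousAt (isOpen_Ioo.mem_nhds ha))).congr_of_eventuallyEq ?_
  filter_upwards [isOpen_Ioo.mem_nhds ha, Iio_mem_nhds hab] with x hx hxb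
  exact h.capArea_eq_right hx hb hxb

/-- Near a chord, the chords that cut off the same area form a curve `b = ψ(a)`. As the areas of
the two infinitesimal sectors swept by the chord are equal, its slope is a quotient of triple
products: the factor `sectorMoment`, symmetric in the endpoints, cancels. -/
theorem exists_equal_area_curve (h : ConvexArc S η ε c c₁ c₂) {a b : ℝ}
    (ha : a ∈ Set.Ioo (-ε) ε) (hb : b ∈ Set.Ioo (-ε) ε) (hab : a < b) :
    ∃ ψ : ℝ → ℝ, ψ a = b ∧
      HasDerivAt ψ (triple (c b) (c a) (c₁ a) / triple (c a) (c b) (c₁ b)) a ∧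
      (∀ᶠ x in 𝓝 a, S.capArea η c c₁ x (ψ x) = S.capArea η c c₁ a b) ∧
      ∀ᶠ v : ℝ × ℝ in 𝓝 (a, b), S.capArea η c c₁ v.1 v.2 = S.capArea η c c₁ a b ↔ ψ v.1 = v.2 := by
  let f₁ : ℝ → ℝ → ℝ →L[ℝ] ℝ := fun x y => (-S.fanDensity η c c₁ y x) • ContinuousLinearMap.id ℝ ℝ
  let f₂ : ℝ → ℝ → ℝ →L[ℝ] ℝ := fun x y => S.fanDensity η c c₁ x y • ContinuousLinearMap.id ℝ ℝ
  have hn : ∀ᶠ v : ℝ × ℝ in 𝓝 (a, b), v.1 ∈ Set.Ioo (-ε) ε ∧ v.2 ∈ Set.Ioo (-ε) ε ∧ v.1 < v.2 :=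
    (continuousAt_fst.eventually (isOpen_Ioo.mem_nhds ha)).and
      ((continuousAt_snd.eventually (isOpen_Ioo.mem_nhds hb)).and
        ((isOpen_lt continuous_fst continuous_snd).mem_nhds hab))
  have df₁ : ∀ᶠ v : ℝ × ℝ in 𝓝 (a, b), HasFDerivAt (S.capArea η c c₁ · v.2) (f₁ v.1 v.2) v.1 := by
    filter_upwards [hn] with v hv
    refine (h.hasDerivAt_capArea_left hv.1 hv.2.1 hv.2.2).hasFDerivAt.congr_fderiv ?_
    ext; simp [f₁]
  have df₂ : ∀ᶠ v : ℝ × ℝ in 𝓝 (a, b), HasFDerivAt (S.capArea η c c₁ v.1 ·) (f₂ v.1 v.2) v.2 := by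
    filter_upwards [hn] with v hv
    refine (h.hasDerivAt_capArea_right hv.1 hv.2.1).hasFDerivAt.congr_fderiv ?_
    ext; simp [f₂]
  have cf₁ : ContinuousAt (fun v : ℝ × ℝ => f₁ v.1 v.2) (a, b) := by
    have := (h.continuousAt_fanDensity hb ha).comp (f := Prod.swap) (x := (a, b))
      continuous_swap.continuousAt
    exact this.neg.smul continuousAt_const
  have cf₂ : ContinuousAt (fun v : ℝ × ℝ => f₂ v.1 v.2) (a, b) :=
    (h.continuousAt_fanDensity ha hb).smul continuousAt_const
  have hpos := h.fanDensity_pos ha hb hab.ne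
  have hinv : (f₂ a b).IsInvertible := by
    refine ⟨ContinuousLinearEquiv.unitsEquivAut ℝ (Units.mk0 _ hpos.ne'), ?_⟩
    ext; simp [f₂]
  have hd := hasStrictFDerivAt_implicitFunctionOfBivariate df₁ df₂ cf₁ cf₂ hinv
  have hiff := eventually_apply_eq_iff_implicitFunctionOfBivariate df₁ df₂ cf₁ cf₂ hinv
  refine ⟨implicitFunctionOfBivariate df₁ df₂ cf₁ cf₂ hinv, hiff.self_of_nhds.1 rfl, ?_,
    eventually_apply_implicitFunctionOfBivariate df₁ df₂ cf₁ cf₂ hinv, hiff⟩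
  have hval : (-(f₂ a b).inverse ∘L f₁ a b) 1 =
      triple (c b) (c a) (c₁ a) / triple (c a) (c b) (c₁ b) := by
    have h1 : f₂ a b ((f₂ a b).inverse (f₁ a b 1)) = f₁ a b 1 := hinv.self_apply_inverse _
    have h2 : S.fanDensity η c c₁ a b * (f₂ a b).inverse (f₁ a b 1) =
        -S.fanDensity η c c₁ b a := by simpa [f₁, f₂] using h1
    have h3 : (-(f₂ a b).inverse ∘L f₁ a b) 1 = -(f₂ a b).inverse (f₁ a b 1) := rfl
    have h4 : triple (c a) (c b) (c₁ b) ≠ 0 := fun h0 => by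
      simp [Geometry.fanDensity, h0] at hpos
    have h5 := sectorMoment_pos (S.polar (c a) (c b))
    rw [h3, eq_div_iff h4]
    simp only [Geometry.fanDensity, S.polar_comm (c b) (c a)] at h2
    refine mul_left_cancel₀ (mul_ne_zero (mul_ne_zero three_ne_zero h5.ne') h.eta_ne_zero) ?_
    linear_combination -h2
  rw [← hval]
  exact hd.hasFDerivAt.hasDerivAt

end ConvexArc

/-! ### The envelope touches each chord at its midpoint -/

theorem mem_span_pair_of_triple_eq_zero {x y w z : R3}
    (hw : triple x y w ≠ 0) (hz : triple x y z = 0) : z ∈ Submodule.span ℝ {x, y} := by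
  have := triple_smul_eq x y w z
  rw [hz, zero_smul, add_zero] at this
  rw [Submodule.mem_span_pair]
  refine ⟨triple z y w / triple x y w, triple x z w / triple x y w, ?_⟩
  rw [div_eq_inv_mul, div_eq_inv_mul, mul_smul, mul_smul, ← smul_add, ← this, smul_smul,
    inv_mul_cancel₀ hw, one_smul]

theorem Geometry.continuousAt_normalize (S : Geometry) {x : R3}
    (hx : 0 < S.polar x x) : ContinuousAt S.normalize x := by
  have h1 : Continuous fun y => S.polar y y :=
    S.continuous_polar.comp (continuous_id.prodMk continuous_id)
  exact ((h1.continuousAt.sqrt).inv₀ (Real.sqrt_pos.2 hx).ne').smul continuousAt_id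

theorem Geometry.centralSymmetry_midpoint (S : Geometry) {x y : R3}
    (hx : x ∈ S.surface) (hy : y ∈ S.surface) (hxy : 0 < S.polar x y) :
    S.centralSymmetry (S.normalize (x + y)) x = y := by
  have hq : S.polar (x + y) (x + y) = 2 + 2 * S.polar x y := by
    have := S.polar_comb hx hy 1 1
    simp only [one_smul] at this
    rw [this]; ring
  have hx1 := S.polar_self hx
  have hk : (Real.sqrt (S.polar (x + y) (x + y)))⁻¹ ^ 2 * (2 + 2 * S.polar x y) = 1 := by
    rw [inv_pow, hq, Real.sq_sqrt (by positivity), inv_mul_cancel₀ (by positivity)]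
  have hk0 : 0 < (Real.sqrt (S.polar (x + y) (x + y)))⁻¹ :=
    inv_pos.2 (Real.sqrt_pos.2 (by rw [hq]; positivity))
  rw [Geometry.normalize]
  set k := (Real.sqrt (S.polar (x + y) (x + y)))⁻¹
  cases S
  · have hx2 : x 2 = 1 := hx
    have hy2 : y 2 = 1 := hy
    have hσ : Geometry.polar .euclidean x y = 1 := by
      simp [Geometry.polar, Geometry.curvature, hx2, hy2]
    rw [hσ] at hk
    have : k = 1 / 2 := by nlinarith
    ext i
    simp [Geometry.centralSymmetry, this]
  · have hf : Geometry.form .spherical (k • (x + y)) x =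
        k * (1 + Geometry.polar .spherical x y) := by
      simp [Geometry.form, Geometry.polar, Geometry.curvature] at hx1 ⊢
      linear_combination k * hx1
    ext i
    simp only [Geometry.centralSymmetry, hf, Pi.sub_apply, Pi.smul_apply, Pi.add_apply, smul_eq_mul]
    linear_combination (x i + y i) * hk
  · have hf : Geometry.form .hyperbolic (k • (x + y)) x =
        -(k * (1 + Geometry.polar .hyperbolic x y)) := by
      simp [Geometry.form, Geometry.polar, Geometry.curvature] at hx1 ⊢
      linear_combination (-k) * hx1
    ext i
    simp only [Geometry.centralSymmetry, hf, Pi.sub_apply, Pi.smul_apply, Pi.add_apply, smul_eq_mul]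
    linear_combination (x i + y i) * hk

namespace ConvexArc

variable {S : Geometry} {η ε : ℝ} {c c₁ c₂ : ℝ → R3}

/-- The geodesic through `c a`, `c b` touches the envelope of the geodesics that cut off the same
area at the midpoint of the chord. By the identity
`(P × Q) × (P' × Q') = det (P, Q, Q') P' - det (P, Q, P') Q'`, a neighbouring geodesic through
`P'`, `Q'` meets it in the direction `P' + ρ Q'` with `ρ = -det (P, Q, P') / det (P, Q, Q')`, and
equality of the areas forces `ρ → 1`. -/
theorem touchesEnvelopeAt_midpoint (h : ConvexArc S η ε c c₁ c₂) {a b : ℝ}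
    (ha : a ∈ Set.Ioo (-ε) ε) (hb : b ∈ Set.Ioo (-ε) ε) (hab : a < b) :
    S.TouchesEnvelopeAt c (S.capArea η c c₁ a b) (a, b) (S.normalize (c a + c b)) := by
  have hM := S.comb_pos (h.mem a ha) (h.mem b hb) (h.polar_pos a ha b hb) zero_le_one one_pos
  rw [one_smul, one_smul] at hM
  refine ⟨⟨hab, h.area_cap ha hb hab⟩, S.normalize_mem hM.1 hM.2, fun U hU => ?_⟩
  obtain ⟨ψ, hψa, hψ', -, hiff⟩ := h.exists_equal_area_curve ha hb hab
  -- the quotient `ρ` and its limit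
  let T₁ : ℝ → ℝ := fun x => triple (c a) (c b) (c x)
  let T₂ : ℝ → ℝ := fun x => triple (c a) (c b) (c (ψ x))
  let ρ : ℝ → ℝ := fun x => -(T₁ x / T₂ x)
  have hd₁ : triple (c b) (c a) (c₁ a) ≠ 0 := fun h0 => by
    have := h.fanDensity_pos hb ha hab.ne'
    simp [Geometry.fanDensity, h0] at this
  have hd₂ : triple (c a) (c b) (c₁ b) ≠ 0 := fun h0 => by
    have := h.fanDensity_pos ha hb hab.ne
    simp [Geometry.fanDensity, h0] at this
  have hs₁ : Tendsto (slope T₁ a) (𝓝[≠] a) (𝓝 (-triple (c b) (c a) (c₁ a))) := by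
    have e : -triple (c b) (c a) (c₁ a) = triple (c a) (c b) (c₁ a) := by simp [triple]; ring
    rw [e]
    exact hasDerivAt_iff_tendsto_slope.1 (hasDerivAt_triple_third (h.hasDerivAt a ha) _ _)
  have hs₂ : Tendsto (slope T₂ a) (𝓝[≠] a) (𝓝 (triple (c b) (c a) (c₁ a))) := by
    have h1 : HasDerivAt (fun x => triple (c a) (c b) (c x)) (triple (c a) (c b) (c₁ b)) (ψ a) := by
      rw [hψa]; exact hasDerivAt_triple_third (h.hasDerivAt b hb) _ _
    have h2 := h1.comp a hψ'
    rw [mul_div_cancel₀ _ hd₂] at h2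
    exact hasDerivAt_iff_tendsto_slope.1 h2
  have hT₁ : T₁ a = 0 := triple_self_outer _ _
  have hT₂ : T₂ a = 0 := by simp only [T₂, hψa]; exact triple_self_right _ _
  have hρ : Tendsto ρ (𝓝[≠] a) (𝓝 1) := by
    have h1 := (hs₁.div hs₂ hd₁).neg
    rw [neg_div, neg_neg, div_self hd₁] at h1
    refine h1.congr' ?_
    filter_upwards [self_mem_nhdsWithin] with x hx
    have : x - a ≠ 0 := sub_ne_zero.2 hx
    simp only [ρ, slope_def_field, hT₁, hT₂, sub_zero, Pi.div_apply]
    rw [div_div_div_cancel_right₀ this]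
  have hT₂ne : ∀ᶠ x in 𝓝[≠] a, T₂ x ≠ 0 := by
    filter_upwards [hs₂.eventually_ne hd₁] with x hx h0
    simp [slope_def_field, hT₂, h0] at hx
  have hψc : Tendsto ψ (𝓝 a) (𝓝 b) := by
    have := hψ'.continuousAt.tendsto
    rwa [hψa] at this
  -- the intersection point and its limit
  let z : ℝ → R3 := fun x => (1 : ℝ) • c x + ρ x • c (ψ x)
  have hca : Tendsto c (𝓝[≠] a) (𝓝 (c a)) := (h.continuousAt ha).tendsto.mono_left nhdsWithin_le_nhds
  have hcb : Tendsto (fun x => c (ψ x)) (𝓝[≠] a) (𝓝 (c b)) :=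
    ((h.continuousAt hb).tendsto.comp hψc).mono_left nhdsWithin_le_nhds
  have hz : Tendsto z (𝓝[≠] a) (𝓝 (c a + c b)) := by
    have := (hca.const_smul (1 : ℝ)).add (hρ.smul hcb)
    rwa [one_smul, one_smul] at this
  have hN : ∀ᶠ x in 𝓝[≠] a, S.normalize (z x) ∈ U :=
    ((S.continuousAt_normalize hM.1).tendsto.comp hz).eventually hU
  have hx : ∀ᶠ x in 𝓝[≠] a, (U ∩ S.geodesic (c a) (c b) ∩ S.geodesic (c x) (c (ψ x))).Nonempty := by
    filter_upwards [hN, hT₂ne, hρ.eventually (lt_mem_nhds one_pos),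
      nhdsWithin_le_nhds (isOpen_Ioo.mem_nhds ha),
      nhdsWithin_le_nhds (hψc.eventually (isOpen_Ioo.mem_nhds hb))] with x h1 h2 h3 h4 h5
    obtain ⟨h6, h7⟩ := S.comb_pos (h.mem _ h4) (h.mem _ h5) (h.polar_pos _ h4 _ h5)
      zero_le_one h3
    have h8 := S.normalize_mem h6 h7
    refine ⟨S.normalize (z x), ⟨h1, h8, ?_⟩, h8, ?_⟩
    · refine Submodule.smul_mem _ _ (mem_span_pair_of_triple_eq_zero hd₂ ?_)
      simp only [z, triple_add_smul_third]
      change 1 * T₁ x + ρ x * T₂ x = 0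
      simp only [ρ]
      field_simp
      ring
    · refine Submodule.smul_mem _ _ (Submodule.mem_span_pair.2 ⟨_, _, rfl⟩)
  have hle : 𝓝[S.areaChords c (S.capArea η c c₁ a b) \ {(a, b)}] (a, b) ≤ 𝓝 (a, b) :=
    nhdsWithin_le_nhds
  have hgraph : ∀ᶠ v : ℝ × ℝ in 𝓝[S.areaChords c (S.capArea η c c₁ a b) \ {(a, b)}] (a, b),
      ψ v.1 = v.2 ∧ v.1 ≠ a := by
    filter_upwards [hle hiff, self_mem_nhdsWithin,
      hle (continuousAt_fst.eventually (isOpen_Ioo.mem_nhds ha)),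
      hle (continuousAt_snd.eventually (isOpen_Ioo.mem_nhds hb))] with v h1 h2 h3 h4
    have h5 := h2.1.2
    rw [h.area_cap h3 h4 h2.1.1] at h5
    have h6 := (ENNReal.ofReal_eq_ofReal_iff (h.capArea_pos h3 h4 h2.1.1).le
      (h.capArea_pos ha hb hab).le).1 h5
    refine ⟨h1.1 h6, fun h7 => h2.2 ?_⟩
    have h8 := h1.1 h6
    rw [h7, hψa] at h8
    exact Prod.ext h7 h8.symm
  have hfst : Tendsto Prod.fst (𝓝[S.areaChords c (S.capArea η c c₁ a b) \ {(a, b)}] (a, b))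
      (𝓝[≠] a) :=
    tendsto_nhdsWithin_iff.2 ⟨continuousAt_fst.tendsto.mono_left hle, hgraph.mono fun v hv => hv.2⟩
  filter_upwards [hfst.eventually hx, hgraph] with v h1 h2
  rwa [h2.1] at h1

theorem outerBilliardStep (h : ConvexArc S η ε c c₁ c₂) {a b : ℝ} {I : Set ℝ}
    (ha : a ∈ Set.Ioo (-ε) ε) (hb : b ∈ Set.Ioo (-ε) ε) (hab : a < b) (haI : a ∈ I) (hbI : b ∈ I) :
    S.OuterBilliardStep c I (S.capArea η c c₁ a b) a b :=
  ⟨haI, hbI, b, hbI, _, h.touchesEnvelopeAt_midpoint ha hb hab,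
    (S.centralSymmetry_midpoint (h.mem a ha) (h.mem b hb) (h.polar_pos a ha b hb)).symm⟩

end ConvexArc

/-! ### The conic -/

/-- If `⟨x(b), w(a)⟩` is symmetric in `a, b` and the values of `x` span the space, then `w` is the
image of `x` under a symmetric matrix. -/
theorem exists_isSymm_mulVec_eq {J : Set ℝ} {x w : ℝ → R3}
    (hsym : ∀ a ∈ J, ∀ b ∈ J, x b ⬝ᵥ w a = x a ⬝ᵥ w b) {s : Fin 3 → ℝ} (hs : ∀ i, s i ∈ J)
    (hdet : (Matrix.of fun i => x (s i)).det ≠ 0) :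
    ∃ N : Matrix (Fin 3) (Fin 3) ℝ, N.IsSymm ∧ ∀ t ∈ J, N.mulVec (x t) = w t := by
  set X : Matrix (Fin 3) (Fin 3) ℝ := Matrix.of fun i => x (s i) with hX
  set W : Matrix (Fin 3) (Fin 3) ℝ := Matrix.of fun i => w (s i) with hW
  have hu : IsUnit X.det := isUnit_iff_ne_zero.2 hdet
  have h1 : X * W.transpose = W * X.transpose := by
    ext i j
    change x (s i) ⬝ᵥ w (s j) = w (s i) ⬝ᵥ x (s j)
    rw [hsym _ (hs j) _ (hs i), dotProduct_comm]
  have h2 : X * (X⁻¹ * W) = W := Matrix.mul_nonsing_inv_cancel_left _ _ hu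
  refine ⟨X⁻¹ * W, ?_, fun t ht => ?_⟩
  · have hu' : IsUnit X.transpose.det := by rwa [Matrix.det_transpose]
    have h3 : X * (X⁻¹ * W).transpose * X.transpose = X * (X⁻¹ * W) * X.transpose := by
      rw [Matrix.mul_assoc, ← Matrix.transpose_mul, h2, h1]
    have h4 := congrArg (fun A => X⁻¹ * (A * X.transpose⁻¹)) h3
    simp only [Matrix.mul_nonsing_inv_cancel_right _ _ hu',
      Matrix.nonsing_inv_mul_cancel_left _ _ hu] at h4
    exact h4
  · have h3 : W.mulVec (x t) = X.mulVec (w t) := by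
      ext i
      change w (s i) ⬝ᵥ x t = x (s i) ⬝ᵥ w t
      rw [hsym _ ht _ (hs i), dotProduct_comm]
    rw [← Matrix.mulVec_mulVec, h3, Matrix.mulVec_mulVec, Matrix.nonsing_inv_mul _ hu,
      Matrix.one_mulVec]

/-- The vector that represents the linear form `S.polar x`. -/
def Geometry.polarVec (S : Geometry) (x : R3) : R3 :=
  ![S.curvature * x 0, S.curvature * x 1, x 2]

/-- A regular arc contained in a conic that is nonsingular at the base point fills the conic near
that point. Two nearby points of the conic with the same coordinate along the tangent
coincide: by polarization, their difference is annihilated by three independent linear forms. -/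
theorem isConicGerm_of_mulVec_eq (S : Geometry) {γ : ℝ → R3} {v : R3}
    {N : Matrix (Fin 3) (Fin 3) ℝ} {k : ℝ} (hN : N.IsSymm) (hk : k ≠ 0) (hv : v ≠ 0)
    (hd : HasStrictDerivAt γ v 0) (h0 : γ 0 ∈ S.surface) (hv0 : S.polar (γ 0) v = 0)
    (hN0 : N.mulVec (γ 0) = k • crossProduct (γ 0) v)
    (hγ : ∀ᶠ s in 𝓝 (0 : ℝ), γ s ∈ S.conic N) : S.IsConicGerm γ := by
  have hvv : 0 < v ⬝ᵥ v := by
    refine lt_of_le_of_ne (Finset.sum_nonneg fun i _ => mul_self_nonneg _) fun h => hv ?_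
    exact dotProduct_self_eq_zero.1 h.symm
  have hdet0 : triple (S.polarVec (γ 0 + γ 0)) (N.mulVec (γ 0 + γ 0)) v ≠ 0 := by
    have e : triple (S.polarVec (γ 0 + γ 0)) (N.mulVec (γ 0 + γ 0)) v =
        4 * k * (γ 0 ⬝ᵥ v * S.polar (γ 0) v - v ⬝ᵥ v * S.polar (γ 0) (γ 0)) := by
      rw [Matrix.mulVec_add, hN0]
      simp [triple, Geometry.polarVec, Geometry.polar, cross_apply, dotProduct, Fin.sum_univ_three]
      ring
    rw [e, hv0, S.polar_self h0]
    simp [hk, hvv.ne']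
  have hcont : Continuous fun p : R3 × R3 =>
      triple (S.polarVec (p.1 + p.2)) (N.mulVec (p.1 + p.2)) v := by
    have h1 : Continuous fun p : R3 × R3 => S.polarVec (p.1 + p.2) := by
      refine continuous_pi fun i => ?_
      fin_cases i <;> simp [Geometry.polarVec] <;> fun_prop
    have h2 : Continuous fun p : R3 × R3 => N.mulVec (p.1 + p.2) :=
      continuous_const.matrix_mulVec (continuous_fst.add continuous_snd)
    exact continuous_triple.comp (h1.prodMk (h2.prodMk continuous_const))
  obtain ⟨U, hU, hUinj⟩ : ∃ U ∈ 𝓝 (γ 0), ∀ x ∈ U, ∀ y ∈ U,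
      triple (S.polarVec (x + y)) (N.mulVec (x + y)) v ≠ 0 := by
    have h1 : ∀ᶠ p : R3 × R3 in 𝓝 (γ 0, γ 0),
        triple (S.polarVec (p.1 + p.2)) (N.mulVec (p.1 + p.2)) v ≠ 0 :=
      hcont.continuousAt.eventually_ne hdet0
    rw [nhds_prod_eq] at h1
    obtain ⟨U, hU, h2⟩ := (Filter.eventually_prod_self_iff (r := fun x y =>
      triple (S.polarVec (x + y)) (N.mulVec (x + y)) v ≠ 0)).1 h1
    exact ⟨U, hU, h2⟩
  have hinj : ∀ x ∈ U, ∀ y ∈ U, x ∈ S.conic N → y ∈ S.conic N → x ⬝ᵥ v = y ⬝ᵥ v → x = y := by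
    intro x hxU y hyU hx hy hxy
    have hne := hUinj x hxU y hyU
    have e1 : (x - y) ⬝ᵥ S.polarVec (x + y) = 0 := by
      have h1 := S.polar_self hx.1
      have h2 := S.polar_self hy.1
      simp only [Geometry.polar] at h1 h2
      simp [Geometry.polarVec, dotProduct, Fin.sum_univ_three]
      linear_combination h1 - h2
    have e2 : (x - y) ⬝ᵥ N.mulVec (x + y) = 0 := by
      have h3 : x ⬝ᵥ N.mulVec y = y ⬝ᵥ N.mulVec x := by
        rw [Matrix.dotProduct_mulVec, ← Matrix.mulVec_transpose, hN.eq, dotProduct_comm]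
      rw [Matrix.mulVec_add, sub_dotProduct, dotProduct_add, dotProduct_add, hx.2, hy.2, h3]
      ring
    have e3 : (x - y) ⬝ᵥ v = 0 := by rw [sub_dotProduct, hxy, sub_self]
    have hM : (Matrix.of ![S.polarVec (x + y), N.mulVec (x + y), v]).det ≠ 0 := by
      rwa [det_eq_triple]
    refine sub_eq_zero.1 (Matrix.eq_zero_of_mulVec_eq_zero hM ?_)
    ext i
    fin_cases i
    · exact (dotProduct_comm _ _).trans e1
    · exact (dotProduct_comm _ _).trans e2
    · exact (dotProduct_comm _ _).trans e3
  have hf : HasStrictDerivAt (fun s => γ s ⬝ᵥ v) (v ⬝ᵥ v) 0 := by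
    have h1 := hasStrictDerivAt_pi.1 hd
    have h2 := (((h1 0).mul_const (v 0)).add ((h1 1).mul_const (v 1))).add ((h1 2).mul_const (v 2))
    simpa only [dotProduct, Fin.sum_univ_three] using! h2
  have hmap := hf.map_nhds_eq hvv.ne'
  have hγc : ContinuousAt γ 0 := hd.hasDerivAt.continuousAt
  refine ⟨N, ?_, hN, ?_⟩
  · rintro rfl
    simp [triple] at hdet0
  obtain ⟨ε, hε, hεγ⟩ := Metric.eventually_nhds_iff.1 hγ
  filter_upwards [Ioo_mem_nhdsGT hε] with δ hδ
  have hV : ∀ᶠ s in 𝓝 (0 : ℝ), s ∈ Set.Ioo (-δ) δ ∧ γ s ∈ U :=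
    (eventually_mem_set.2 (Ioo_mem_nhds (neg_lt_zero.2 hδ.1) hδ.1)).and (hγc.eventually hU)
  have himg : ∀ᶠ r in 𝓝 (γ 0 ⬝ᵥ v), ∃ s, (s ∈ Set.Ioo (-δ) δ ∧ γ s ∈ U) ∧ γ s ⬝ᵥ v = r := by
    rw [← hmap]
    refine eventually_map.2 (hV.mono fun s hs => ?_)
    exact ⟨s, hs, rfl⟩
  have hcv : Continuous fun x : R3 => x ⬝ᵥ v := by
    simp only [dotProduct]; fun_prop
  have hsmall : ∀ s ∈ Set.Ioo (-δ) δ, γ s ∈ S.conic N := fun s hs => hεγ (by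
    rw [Real.dist_0_eq_abs, abs_lt]
    constructor <;> linarith [hs.1, hs.2, hδ.2])
  filter_upwards [hcv.continuousAt.eventually himg, hU] with x hx hxU
  constructor
  · rintro ⟨s, hs, rfl⟩
    exact hsmall s hs
  · intro hxc
    obtain ⟨s, ⟨hs, hsU⟩, he⟩ := hx
    exact ⟨s, hs, hinj _ hsU _ hxU (hsmall s hs) hxc he⟩

/-! ### From the germ to a convex arc -/

theorem ConvexArc.mono {S : Geometry} {η ε ε' : ℝ} {c c₁ c₂ : ℝ → R3}
    (h : ConvexArc S η ε c c₁ c₂) (hε : ε' ≤ ε) : ConvexArc S η ε' c c₁ c₂ := by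
  have hsub : Set.Ioo (-ε') ε' ⊆ Set.Ioo (-ε) ε := Set.Ioo_subset_Ioo (neg_le_neg hε) hε
  exact ⟨h.abs_eta, fun s hs => h.mem s (hsub hs), fun s hs => h.hasDerivAt s (hsub hs),
    fun s hs => h.hasDerivAt₁ s (hsub hs),
    fun r hr s hs u hu => h.pos r (hsub hr) s (hsub hs) u (hsub hu),
    fun r hr s hs => h.polar_pos r (hsub hr) s (hsub hs)⟩

theorem contDiffAt_deriv {E : Type*} [NormedAddCommGroup E] [NormedSpace ℝ E] {f : ℝ → E}
    {m n : WithTop ℕ∞} {x : ℝ} (hf : ContDiffAt ℝ n f x) (hmn : m + 1 ≤ n) :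
    ContDiffAt ℝ m (deriv f) x :=
  (hf.fderiv_right hmn).clm_apply contDiffAt_const

theorem IsConvexGerm.exists_convexArc {S : Geometry} {γ : ℝ → R3} (hγ : IsConvexGerm S γ) :
    ∃ η ε : ℝ, 0 < ε ∧ ConvexArc S η ε γ (deriv γ) (deriv (deriv γ)) := by
  have hC := hγ.contDiffAt
  have hC₁ : ContDiffAt ℝ 1 (deriv γ) 0 := contDiffAt_deriv hC (by norm_num)
  have hC₂ : ContDiffAt ℝ 0 (deriv (deriv γ)) 0 := contDiffAt_deriv hC₁ (by norm_num)
  have hd : triple (γ 0) (deriv γ 0) (deriv (deriv γ) 0) ≠ 0 := by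
    rw [← det_eq_triple]
    intro h0
    exact hγ.curvature_ne_zero (by rw [Geometry.geodesicCurvature, h0, zero_div])
  obtain ⟨η, hη, hpos⟩ : ∃ η : ℝ, |η| = 1 ∧
      0 < η * triple (γ 0) (deriv γ 0) (deriv (deriv γ) 0) := by
    rcases lt_or_gt_of_ne hd with h | h
    · exact ⟨-1, by simp, by linarith⟩
    · exact ⟨1, by simp, by linarith⟩
  have h1 : ∀ᶠ s in 𝓝 (0 : ℝ), HasDerivAt γ (deriv γ s) s :=
    (hC.eventually (by norm_num)).mono fun s hs =>
      (hs.differentiableAt (by norm_num)).hasDerivAt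
  have h2 : ∀ᶠ s in 𝓝 (0 : ℝ), HasDerivAt (deriv γ) (deriv (deriv γ) s) s :=
    (hC₁.eventually (by norm_num)).mono fun s hs =>
      (hs.differentiableAt (by norm_num)).hasDerivAt
  have h3 : ∀ᶠ v : ℝ × ℝ × ℝ in 𝓝 (0, 0, 0),
      0 < η * triple (γ v.1) (deriv γ v.2.1) (deriv (deriv γ) v.2.2) := by
    have e1 : ContinuousAt (fun v : ℝ × ℝ × ℝ => γ v.1) (0, 0, 0) :=
      hC.continuousAt.comp (f := Prod.fst) continuousAt_fst
    have e2 : ContinuousAt (fun v : ℝ × ℝ × ℝ => deriv γ v.2.1) (0, 0, 0) :=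
      hC₁.continuousAt.comp (f := fun v : ℝ × ℝ × ℝ => v.2.1) (x := (0, 0, 0)) (by fun_prop)
    have e3 : ContinuousAt (fun v : ℝ × ℝ × ℝ => deriv (deriv γ) v.2.2) (0, 0, 0) :=
      hC₂.continuousAt.comp (f := fun v : ℝ × ℝ × ℝ => v.2.2) (x := (0, 0, 0)) (by fun_prop)
    have e4 : ContinuousAt (fun v : ℝ × ℝ × ℝ =>
        η * triple (γ v.1) (deriv γ v.2.1) (deriv (deriv γ) v.2.2)) (0, 0, 0) :=
      continuousAt_const.mul (continuous_triple.continuousAt.comp (e1.prodMk (e2.prodMk e3)))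
    exact e4.eventually (lt_mem_nhds hpos)
  have h4 : ∀ᶠ v : ℝ × ℝ in 𝓝 (0, 0), 0 < S.polar (γ v.1) (γ v.2) := by
    have e1 : ContinuousAt (fun v : ℝ × ℝ => γ v.1) (0, 0) :=
      hC.continuousAt.comp (f := Prod.fst) continuousAt_fst
    have e2 : ContinuousAt (fun v : ℝ × ℝ => γ v.2) (0, 0) :=
      hC.continuousAt.comp (f := Prod.snd) (x := (0, 0)) continuousAt_snd
    have e3 : ContinuousAt (fun v : ℝ × ℝ => S.polar (γ v.1) (γ v.2)) (0, 0) :=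
      S.continuous_polar.continuousAt.comp (e1.prodMk e2)
    refine e3.eventually (lt_mem_nhds ?_)
    change 0 < S.polar (γ 0) (γ 0)
    rw [S.polar_self hγ.mem_surface.self_of_nhds]
    exact one_pos
  obtain ⟨ε₁, hε₁, k₁⟩ := Metric.eventually_nhds_iff.1 ((hγ.mem_surface.and h1).and h2)
  obtain ⟨ε₃, hε₃, k₃⟩ := Metric.eventually_nhds_iff.1 h3
  obtain ⟨ε₄, hε₄, k₄⟩ := Metric.eventually_nhds_iff.1 h4
  have hlt : ∀ s ∈ Set.Ioo (-min ε₁ (min ε₃ ε₄)) (min ε₁ (min ε₃ ε₄)),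
      dist s 0 < ε₁ ∧ dist s 0 < ε₃ ∧ dist s 0 < ε₄ := fun s hs => by
    have : dist s 0 < min ε₁ (min ε₃ ε₄) := by
      rw [Real.dist_0_eq_abs]; exact abs_lt.2 hs
    simpa only [lt_min_iff] using this
  refine ⟨η, min ε₁ (min ε₃ ε₄), lt_min hε₁ (lt_min hε₃ hε₄), hη,
    fun s hs => (k₁ (hlt s hs).1).1.1, fun s hs => (k₁ (hlt s hs).1).1.2,
    fun s hs => (k₁ (hlt s hs).1).2, fun r hr s hs u hu => k₃ (y := (r, s, u)) ?_,
    fun r hr s hs => k₄ (y := (r, s)) ?_⟩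
  · exact max_lt (hlt r hr).2.1 (max_lt (hlt s hs).2.1 (hlt u hu).2.1)
  · exact max_lt (hlt r hr).2.2 (hlt s hs).2.2

/-! ### Differentiating the translation property -/

namespace ConvexArc

variable {S : Geometry} {η ε : ℝ} {c c₁ c₂ : ℝ → R3}

/-- Caps over sufficiently short arcs have small area. -/
theorem exists_capArea_lt (h : ConvexArc S η ε c c₁ c₂) (hε : 0 < ε) {p : ℝ} (hp : 0 < p) :
    ∃ ε' > 0, ∀ a ∈ Set.Ioo (-ε') ε', ∀ b ∈ Set.Ioo (-ε') ε', S.capArea η c c₁ a b < p := by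
  have h0 : (0 : ℝ) ∈ Set.Ioo (-ε) ε := ⟨neg_lt_zero.2 hε, hε⟩
  have h1 : ∀ᶠ v : ℝ × ℝ in 𝓝 (0, 0), ‖S.fanDensity η c c₁ v.1 v.2‖ < 1 := by
    refine (h.continuousAt_fanDensity h0 h0).norm.eventually (gt_mem_nhds ?_)
    simp [Geometry.fanDensity, triple_self_left]
  obtain ⟨ε₁, hε₁, k₁⟩ := Metric.eventually_nhds_iff.1 h1
  refine ⟨min ε₁ (p / 2), lt_min hε₁ (half_pos hp), fun a ha b hb => ?_⟩
  have hlt : ∀ s ∈ Set.Ioo (-min ε₁ (p / 2)) (min ε₁ (p / 2)), dist s 0 < ε₁ := fun s hs => by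
    rw [Real.dist_0_eq_abs]
    exact (abs_lt.2 hs).trans_le (min_le_left _ _)
  have h2 : ‖S.capArea η c c₁ a b‖ ≤ 1 * |b - a| := by
    refine intervalIntegral.norm_integral_le_of_norm_le_const fun s hs => ?_
    have hs' := Set.ordConnected_Ioo.uIcc_subset ha hb (Set.uIoc_subset_uIcc hs)
    exact (k₁ (y := (a, s)) (max_lt (hlt a ha) (hlt s hs'))).le
  have h3 : |b - a| < p := by
    have := min_le_right ε₁ (p / 2)
    rw [abs_lt]
    constructor <;> linarith [ha.1, ha.2, hb.1, hb.2]
  linarith [le_abs_self (S.capArea η c c₁ a b), Real.norm_eq_abs (S.capArea η c c₁ a b)]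

/-- Differentiation of `t(b) - t(a)` along a curve of chords that cut off the same area. -/
theorem deriv_mul_triple_eq (h : ConvexArc S η ε c c₁ c₂) {t : ℝ → ℝ}
    (ht : ∀ s ∈ Set.Ioo (-ε) ε, DifferentiableAt ℝ t s)
    (hT : ∀ a ∈ Set.Ioo (-ε) ε, ∀ b ∈ Set.Ioo (-ε) ε, ∀ a' ∈ Set.Ioo (-ε) ε,
      ∀ b' ∈ Set.Ioo (-ε) ε, a < b → a' < b' → S.capArea η c c₁ a' b' = S.capArea η c c₁ a b →
      t b' - t a' = t b - t a)
    {a b : ℝ} (ha : a ∈ Set.Ioo (-ε) ε) (hb : b ∈ Set.Ioo (-ε) ε) (hab : a < b) :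
    deriv t b * triple (c b) (c a) (c₁ a) = deriv t a * triple (c a) (c b) (c₁ b) := by
  obtain ⟨ψ, hψa, hψ', harea, -⟩ := h.exists_equal_area_curve ha hb hab
  have hψc : Tendsto ψ (𝓝 a) (𝓝 b) := by
    have := hψ'.continuousAt.tendsto
    rwa [hψa] at this
  have hconst : (fun x => t (ψ x) - t x) =ᶠ[𝓝 a] fun _ => t b - t a := by
    have hlt : ∀ᶠ x in 𝓝 a, x < ψ x := tendsto_id.eventually_lt hψc hab
    filter_upwards [harea, hlt, isOpen_Ioo.mem_nhds ha,
      hψc.eventually (isOpen_Ioo.mem_nhds hb)] with x h1 h2 h3 h4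
    exact hT a ha b hb x h3 (ψ x) h4 hab h2 h1
  have hd1 : HasDerivAt t (deriv t b) (ψ a) := by rw [hψa]; exact (ht b hb).hasDerivAt
  have hd := (hd1.comp a hψ').sub (ht a ha).hasDerivAt
  have h0 := hd.unique ((hasDerivAt_const a (t b - t a)).congr_of_eventuallyEq hconst)
  have hd₂ : triple (c a) (c b) (c₁ b) ≠ 0 := fun h0 => by
    have := h.fanDensity_pos ha hb hab.ne
    simp [Geometry.fanDensity, h0] at this
  field_simp at h0
  linarith

theorem polar_deriv_eq_zero (h : ConvexArc S η ε c c₁ c₂) {s : ℝ} (hs : s ∈ Set.Ioo (-ε) ε) :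
    S.polar (c s) (c₁ s) = 0 := by
  have h0 := hasDerivAt_coord (h.hasDerivAt s hs) 0
  have h1 := hasDerivAt_coord (h.hasDerivAt s hs) 1
  have h2 := hasDerivAt_coord (h.hasDerivAt s hs) 2
  have hd := (h2.mul h2).add (((h0.mul h0).add (h1.mul h1)).const_mul S.curvature)
  have hc : (fun u => S.polar (c u) (c u)) =ᶠ[𝓝 s] fun _ => 1 := by
    filter_upwards [isOpen_Ioo.mem_nhds hs] with u hu
    exact S.polar_self (h.mem u hu)
  have := hd.unique ((hasDerivAt_const s (1 : ℝ)).congr_of_eventuallyEq hc)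
  simp only [Geometry.polar]
  linarith

end ConvexArc

end AreaBilliard

theorem theorem1p9 (S : AreaBilliard.Geometry) (γ : ℝ → AreaBilliard.R3)
    (hγ : AreaBilliard.IsConvexGerm S γ) (hP : S.HasAreaPoritskyProperty γ) :
    S.IsConicGerm γ := by
  open AreaBilliard in
  obtain ⟨t, ht, ht0, δ, hδ, p₀, hp₀, hstep⟩ := hP
  obtain ⟨η, ε₀, hε₀, harc₀⟩ := hγ.exists_convexArc
  obtain ⟨ε₁, hε₁, hsmall⟩ := harc₀.exists_capArea_lt hε₀ hp₀
  have ht' : ∀ᶠ s in 𝓝 (0 : ℝ), DifferentiableAt ℝ t s ∧ deriv t s ≠ 0 :=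
    ((ht.eventually (by norm_num)).mono fun s hs => hs.differentiableAt (by norm_num)).and
      ((contDiffAt_deriv ht (m := 0) (by norm_num)).continuousAt.eventually_ne ht0)
  obtain ⟨ε₂, hε₂, htε⟩ := Metric.eventually_nhds_iff.1 ht'
  obtain ⟨ε, hε, hle₀, hle₁, hle₂, hleδ⟩ : ∃ ε > 0, ε ≤ ε₀ ∧ ε ≤ ε₁ ∧ ε ≤ ε₂ ∧ ε ≤ δ :=
    ⟨min (min ε₀ ε₁) (min ε₂ δ), lt_min (lt_min hε₀ hε₁) (lt_min hε₂ hδ),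
      (min_le_left _ _).trans (min_le_left _ _), (min_le_left _ _).trans (min_le_right _ _),
      (min_le_right _ _).trans (min_le_left _ _), (min_le_right _ _).trans (min_le_right _ _)⟩
  have harc := harc₀.mono hle₀
  have hsub : ∀ r, ε ≤ r → Set.Ioo (-ε) ε ⊆ Set.Ioo (-r) r := fun r hr =>
    Set.Ioo_subset_Ioo (neg_le_neg hr) hr
  have htd : ∀ s ∈ Set.Ioo (-ε) ε, DifferentiableAt ℝ t s ∧ deriv t s ≠ 0 := fun s hs => by
    refine htε ?_
    rw [Real.dist_0_eq_abs]
    exact (abs_lt.2 hs).trans_le hle₂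
  have hkey : ∀ a ∈ Set.Ioo (-ε) ε, ∀ b ∈ Set.Ioo (-ε) ε, a < b →
      deriv t b * triple (γ b) (γ a) (deriv γ a) = deriv t a * triple (γ a) (γ b) (deriv γ b) := by
    intro a ha b hb hab
    refine harc.deriv_mul_triple_eq (fun s hs => (htd s hs).1) ?_ ha hb hab
    intro a ha b hb a' ha' b' hb' hab hab' hA
    obtain ⟨k, hk⟩ := hstep _ (harc.capArea_pos ha hb hab)
      (hsmall a (hsub _ hle₁ ha) b (hsub _ hle₁ hb))
    have h1 := hk a b
      (harc.outerBilliardStep ha hb hab (hsub _ hleδ ha) (hsub _ hleδ hb))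
    have h2 := harc.outerBilliardStep ha' hb' hab' (hsub _ hleδ ha') (hsub _ hleδ hb')
    rw [hA] at h2
    rw [h1, hk a' b' h2]
    ring
  let w : ℝ → R3 := fun s => (deriv t s)⁻¹ • crossProduct (γ s) (deriv γ s)
  have hw : ∀ x s, x ⬝ᵥ w s = (deriv t s)⁻¹ * triple x (γ s) (deriv γ s) := fun x s => by
    simp [w, triple, cross_apply, dotProduct, Fin.sum_univ_three]
    ring
  have hsymlt : ∀ a ∈ Set.Ioo (-ε) ε, ∀ b ∈ Set.Ioo (-ε) ε, a < b → γ b ⬝ᵥ w a = γ a ⬝ᵥ w b := by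
    intro a ha b hb hab
    have h1 := (htd a ha).2
    have h2 := (htd b hb).2
    rw [hw, hw, inv_mul_eq_div, inv_mul_eq_div, div_eq_div_iff h1 h2]
    linarith [hkey a ha b hb hab]
  have hsym : ∀ a ∈ Set.Ioo (-ε) ε, ∀ b ∈ Set.Ioo (-ε) ε, γ b ⬝ᵥ w a = γ a ⬝ᵥ w b := by
    intro a ha b hb
    rcases lt_trichotomy a b with hab | rfl | hab
    · exact hsymlt a ha b hb hab
    · rfl
    · exact (hsymlt b hb a ha hab).symm
  have h0 : (0 : ℝ) ∈ Set.Ioo (-ε) ε := ⟨neg_lt_zero.2 hε, hε⟩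
  have hl : -(ε / 2) ∈ Set.Ioo (-ε) ε := ⟨by linarith, by linarith⟩
  have hr : ε / 2 ∈ Set.Ioo (-ε) ε := ⟨by linarith, by linarith⟩
  obtain ⟨N, hN, hNw⟩ := exists_isSymm_mulVec_eq hsym (s := ![-(ε / 2), 0, ε / 2])
    (by intro i; fin_cases i; exacts [hl, h0, hr]) (by
      have h1 := harc.triple_pos hl hr (v := 0) (by linarith) (by linarith)
      have h2 : (fun i => γ (![-(ε / 2), 0, ε / 2] i)) = ![γ (-(ε / 2)), γ 0, γ (ε / 2)] := by
        funext i; fin_cases i <;> rfl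
      rw [h2, det_eq_triple]
      intro h3
      simp [h3] at h1)
  refine isConicGerm_of_mulVec_eq S hN (inv_ne_zero ht0) hγ.regular
    (hγ.contDiffAt.hasStrictDerivAt (by norm_num)) (harc.mem 0 h0) (harc.polar_deriv_eq_zero h0)
    (hNw 0 h0) ?_
  filter_upwards [isOpen_Ioo.mem_nhds h0] with s hs
  refine ⟨harc.mem s hs, ?_⟩
  rw [hNw s hs, hw, triple_self_left, mul_zero]
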